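/- Let $k$ be a field of characteristic zero. Let $W=k^7$ be the space of column vectors with standard basis $e_1,\dots,e_7$, write $e_{ijl}=e_i\wedge e_j\wedge e_l$ and $e_{ij}=e_i\wedge e_j$, and put $$\bar w=e_{234}+e_{567}+e_1\wedge(e_{25}+e_{36}+e_{47})\in\wedge^3W .$$ Let $G_1\subset \mathrm{GL}(7)$ be the closed subgroup of all $g$ with $g\bar w=c(g)\bar w$ for some $c(g)\in\mathrm{GL}(1)$, and let $G=G_1\times\mathrm{GL}(2)$. Let $V=W\otimes k^2$, regarded as the space of linear forms $M(v)=v_1x_1+v_2x_2$ ($x_1,x_2\in W$) in $v=(v_1,v_2)$, on which $(g_1,g_2)\in G$ acts by $M(v)\mapsto g_1M(vg_2)$. Let $w=v_1e_2+v_2e_5\in V$, let $G_w$ be the stabilizer of $w$ in $G$, $G_w^0$ its identity component, and $\tilde T=\mathrm{Ker}(G\to\mathrm{GL}(V))$. All of these are algebraic groups over $k$. For $A\in\mathrm{GL}(2)$ let $d(A)=(d_1(A),d_2(A))$, where $d_1(A)$ is block diagonal with blocks $1,\ (\det A)^{-1},\ A,\ \det A,\ {}^tA^{-1}$ and $d_2(A)=\mathrm{diag}(\det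 A,(\det A)^{-1})$. Let $\tau=(\tau_1,\tau_2)$, where $\tau_1$ is the linear map fixing $e_1$, exchanging $e_2$ with $e_5$ and $e_3$ with $e_6$, and sending $e_4\mapsto -e_7$, $e_7\mapsto -e_4$, and $\tau_2=\begin{pmatrix}0&1\\1&0\end{pmatrix}$. Then the following statements hold (for algebraic groups over $k$). 1. $\tilde T=\{(t^{-1}I_7,tI_2)\mid t\in\mathrm{GL}(1)\}\cong\mathrm{GL}(1)$, and $(A,z)\mapsto d(A)z$ is an isomorphism $\mathrm{GL}(2)\times\tilde T\cong G_w^0$; that is, for every commutative $k$-algebra $R$ it is an isomorphism on $R$-points. 2. $G_w$ is generated by $G_w^0$ and $\tau$; more precisely, for every commutative $k$-algebra $R$ with connected spectrum (in particular for every extension field of $k$) the group $G_w(R)$ is generated by $G_w^0(R)$ and $\tau$. 3. There is a split exact sequence of algebraic groups over $k$ $$1\to\mathrm{GL}(2)\times\mathrm{GL}(1)\to G_w\to\mathbb Z/2\mathbb Z\to1,$$ where $\mathbb Z/2\mathbb Z$ is the constant group, the first map is $(A,t)\mapsto d(A)\,(t^{-1}I_7,tI_2)$ with image $G_w^0$,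 and a splitting sends the non-trivial element of $\mathbb Z/2\mathbb Z$ to $\tau$ (so that $\tau$ maps to the non-trivial element). It is exact and split already on $R$-points, for every commutative $k$-algebra $R$. -/

import Mathlib

universe u

open scoped Matrix

namespace CaseTwo

/-- `GL(7) × GL(2)`, evaluated on a commutative ring `R`. -/
abbrev Amb (R : Type u) [CommRing R] : Type u :=
  Matrix.GeneralLinearGroup (Fin 7) R × Matrix.GeneralLinearGroup (Fin 2) R

/-- Extension of scalars `GL(7)_R × GL(2)_R → GL(7)_S × GL(2)_S` along `φ : R → S`. -/
def Amb.map {R S : Type u} [CommRing R] [CommRing S] (φ : R →+* S) : Amb R →* Amb S :=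
  MonoidHom.prodMap (Matrix.GeneralLinearGroup.map φ) (Matrix.GeneralLinearGroup.map φ)

/-! ### The representation -/

/-- The standard basis vector `e_{i+1}` of `W = R⁷` (indices start at `0` here). -/
def e (R : Type u) [CommRing R] (i : Fin 7) : Fin 7 → R := Pi.single i 1

/-- `e_{i+1} ∧ e_{j+1} ∧ e_{l+1}` in `⋀³ W`. -/
noncomputable def e3 (R : Type u) [CommRing R] (i j l : Fin 7) : ⋀[R]^3 (Fin 7 → R) :=
  exteriorPower.ιMulti R 3 ![e R i, e R j, e R l]

/-- `e₂₃₄ + e₅₆₇ + e₁ ∧ (e₂₅ + e₃₆ + e₄₇)`. -/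
noncomputable def wBar (R : Type u) [CommRing R] : ⋀[R]^3 (Fin 7 → R) :=
  e3 R 1 2 3 + e3 R 4 5 6 + (e3 R 0 1 4 + e3 R 0 2 5 + e3 R 0 3 6)

/-- The natural action of `GL(7)` on `⋀³ W`. -/
noncomputable def wedgeAct {R : Type u} [CommRing R] (g : Matrix.GeneralLinearGroup (Fin 7) R) :
    ⋀[R]^3 (Fin 7 → R) →ₗ[R] ⋀[R]^3 (Fin 7 → R) :=
  exteriorPower.map 3 (Matrix.toLin' (g : Matrix (Fin 7) (Fin 7) R))

/-- The group `G₁` of all `g ∈ GL(7)` such that `g w̄ = c w̄` for some `c ∈ GL(1)`. -/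
noncomputable def G₁ (R : Type u) [CommRing R] : Subgroup (Matrix.GeneralLinearGroup (Fin 7) R) where
  carrier := {g | ∃ c : Rˣ, wedgeAct g (wBar R) = (c : R) • wBar R}
  one_mem' := ⟨1, by simp [wedgeAct]⟩
  mul_mem' := by
    rintro g h ⟨c, hc⟩ ⟨d, hd⟩
    refine ⟨c * d, ?_⟩
    have : wedgeAct (g * h) = wedgeAct g ∘ₗ wedgeAct h := by
      simp [wedgeAct, Matrix.toLin'_mul]
    rw [this, LinearMap.comp_apply, hd, map_smul, hc, smul_smul, Units.val_mul, mul_comm]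
  inv_mem' := by
    rintro g ⟨c, hc⟩
    refine ⟨c⁻¹, ?_⟩
    have : wedgeAct g⁻¹ ∘ₗ wedgeAct g = LinearMap.id := by
      rw [wedgeAct, wedgeAct, ← exteriorPower.map_comp, ← Matrix.toLin'_mul, ← Units.val_mul]
      simp
    have h2 := LinearMap.congr_fun this (wBar R)
    rw [LinearMap.comp_apply, hc, map_smul, LinearMap.id_apply] at h2
    calc wedgeAct g⁻¹ (wBar R)
        = ((c⁻¹ : Rˣ) : R) • ((c : R) • wedgeAct g⁻¹ (wBar R)) := by
          rw [smul_smul, Units.inv_mul, one_smul]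
      _ = _ := by rw [h2]

/-- `G = G₁ × GL(2)`. -/
noncomputable def G (R : Type u) [CommRing R] : Subgroup (Amb R) := (G₁ R).prod ⊤

/-- `V = W ⊗ R²`, regarded as the space of linear forms `M(v)` in `v = (v₁, v₂)` with
entries in `W`. -/
abbrev V (R : Type u) [CommRing R] : Type u := (Fin 2 → R) →ₗ[R] (Fin 7 → R)

/-- The action `(g₁, g₂) M (v) = g₁ M(v g₂)`, where `v` is a row vector. -/
def act {R : Type u} [CommRing R] (g : Amb R) (M : V R) : V R :=
  Matrix.toLin' (g.1 : Matrix (Fin 7) (Fin 7) R) ∘ₗ M ∘ₗ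
    Matrix.vecMulLinear (g.2 : Matrix (Fin 2) (Fin 2) R)

theorem act_apply {R : Type u} [CommRing R] (g : Amb R) (M : V R) (v : Fin 2 → R) :
    act g M v = (g.1 : Matrix (Fin 7) (Fin 7) R) *ᵥ
      M (v ᵥ* (g.2 : Matrix (Fin 2) (Fin 2) R)) := rfl

theorem act_one {R : Type u} [CommRing R] (M : V R) : act 1 M = M := by
  apply LinearMap.ext
  intro v
  simp [act_apply]

theorem act_mul {R : Type u} [CommRing R] (g h : Amb R) (M : V R) :
    act (g * h) M = act g (act h M) := by
  apply LinearMap.ext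
  intro v
  simp [act_apply, Matrix.mulVec_mulVec, Matrix.vecMul_vecMul]

/-- `T̃ = Ker (G → GL(V))`. -/
noncomputable def Ttilde (R : Type u) [CommRing R] : Subgroup (Amb R) where
  carrier := {g | g ∈ G R ∧ ∀ M : V R, act g M = M}
  one_mem' := ⟨one_mem _, act_one⟩
  mul_mem' := fun {g h} hg hh =>
    ⟨mul_mem hg.1 hh.1, fun M => by rw [act_mul, hh.2, hg.2]⟩
  inv_mem' := fun {g} hg => ⟨inv_mem hg.1, fun M => by
    calc act g⁻¹ M = act g⁻¹ (act g M) := by rw [hg.2]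
      _ = M := by rw [← act_mul, inv_mul_cancel, act_one]⟩

/-- The point `w = v₁ e₂ + v₂ e₅`. -/
def w (R : Type u) [CommRing R] : V R :=
  (LinearMap.proj 0 : (Fin 2 → R) →ₗ[R] R).smulRight (e R 1) +
    (LinearMap.proj 1 : (Fin 2 → R) →ₗ[R] R).smulRight (e R 4)

/-- The stabilizer `G_w` of `w` in `G`. -/
noncomputable def Gw (R : Type u) [CommRing R] : Subgroup (Amb R) where
  carrier := {g | g ∈ G R ∧ act g (w R) = w R}
  one_mem' := ⟨one_mem _, act_one _⟩
  mul_mem' := fun {g h} hg hh => ⟨mul_mem hg.1 hh.1, by rw [act_mul, hh.2, hg.2]⟩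
  inv_mem' := fun {g} hg => ⟨inv_mem hg.1, by
    calc act g⁻¹ (w R) = act g⁻¹ (act g (w R)) := by rw [hg.2]
      _ = w R := by rw [← act_mul, inv_mul_cancel, act_one]⟩

/-! ### The identity component -/

/-- The matrix entries of an element of `GL(7) × GL(2)`. -/
def coords {K : Type u} [CommRing K] (g : Amb K) : Fin 7 × Fin 7 ⊕ Fin 2 × Fin 2 → K :=
  Sum.elim (fun p => (g.1 : Matrix (Fin 7) (Fin 7) K) p.1 p.2)
    (fun p => (g.2 : Matrix (Fin 2) (Fin 2) K) p.1 p.2)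

/-- The Zariski topology on `GL(7)_K × GL(2)_K`: the sets where a polynomial in the matrix
entries does not vanish generate it. (Allowing the inverses of the two determinants in the
polynomial gives the same sets.) -/
@[reducible] def zariski (K : Type u) [Field K] : TopologicalSpace (Amb K) :=
  TopologicalSpace.generateFrom
    (Set.range fun p : MvPolynomial (Fin 7 × Fin 7 ⊕ Fin 2 × Fin 2) K =>
      {g : Amb K | MvPolynomial.eval (coords g) p ≠ 0})

/-- The connected component of `1` in the group of `K`-points of `G_w` (of interest for
algebraically closed `K`), for the Zariski topology. -/
def component (K : Type u) [Field K] : Set (Amb K) :=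
  @connectedComponentIn (Amb K) (zariski K) (Gw K : Set (Amb K)) 1

theorem continuous_mulLeft (K : Type u) [Field K] (h : Amb K) :
    @Continuous _ _ (zariski K) (zariski K) (fun g : Amb K => h * g) := by
  let := zariski K
  refine continuous_generateFrom_iff.2 ?_
  rintro _ ⟨p, rfl⟩
  refine TopologicalSpace.isOpen_generateFrom_of_mem ⟨MvPolynomial.bind₁ (Sum.elim
    (fun q => ∑ l, MvPolynomial.C ((h.1 : Matrix (Fin 7) (Fin 7) K) q.1 l) *
      MvPolynomial.X (Sum.inl (l, q.2)))
    (fun q => ∑ l, MvPolynomial.C ((h.2 : Matrix (Fin 2) (Fin 2) K) q.1 l) *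
      MvPolynomial.X (Sum.inr (l, q.2)))) p, ?_⟩
  ext g
  have : coords (h * g) = fun i => MvPolynomial.eval (coords g) ((Sum.elim
    (fun q => ∑ l, MvPolynomial.C ((h.1 : Matrix (Fin 7) (Fin 7) K) q.1 l) *
      MvPolynomial.X (Sum.inl (l, q.2)))
    (fun q => ∑ l, MvPolynomial.C ((h.2 : Matrix (Fin 2) (Fin 2) K) q.1 l) *
      MvPolynomial.X (Sum.inr (l, q.2))) :
        _ → MvPolynomial (Fin 7 × Fin 7 ⊕ Fin 2 × Fin 2) K) i) := by
    funext i
    rcases i with q | q <;> simp [coords, Matrix.mul_apply]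
  rw [Set.mem_preimage, Set.mem_ofPred_eq, Set.mem_ofPred_eq, this,
    MvPolynomial.eval, MvPolynomial.eval₂Hom_bind₁]
  exact Iff.rfl

theorem one_mem_component (K : Type u) [Field K] : (1 : Amb K) ∈ component K :=
  @mem_connectedComponentIn _ (zariski K) _ _ (one_mem (Gw K))

theorem mul_mem_component_of_inv {K : Type u} [Field K] {g h : Amb K}
    (hg : g ∈ Gw K) (hgi : g⁻¹ ∈ component K) (hh : h ∈ component K) :
    g * h ∈ component K := by
  let := zariski K
  have hsub : (fun x => g * x) '' component K ⊆ component K := by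
    apply IsPreconnected.subset_connectedComponentIn
    · exact isPreconnected_connectedComponentIn.image _ (continuous_mulLeft K g).continuousOn
    · exact ⟨g⁻¹, hgi, mul_inv_cancel g⟩
    · rintro _ ⟨x, hx, rfl⟩
      exact mul_mem hg (connectedComponentIn_subset _ _ hx)
  exact hsub ⟨h, hh, rfl⟩

theorem inv_mem_component {K : Type u} [Field K] {g : Amb K} (hg : g ∈ component K) :
    g⁻¹ ∈ component K := by
  let := zariski K
  have hgw : g ∈ Gw K := connectedComponentIn_subset _ _ hg
  simpa using mul_mem_component_of_inv (h := 1) (inv_mem hgw) (by simpa using hg)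
    (one_mem_component K)

theorem mul_mem_component {K : Type u} [Field K] {g h : Amb K}
    (hg : g ∈ component K) (hh : h ∈ component K) : g * h ∈ component K := by
  let := zariski K
  exact mul_mem_component_of_inv (connectedComponentIn_subset _ _ hg) (inv_mem_component hg) hh

/-- The `R`-points of the identity component `G_w⁰`, the open and closed subgroup scheme of
`G_w` on the connected component of `1`. An `R`-point of `G_w` lies in it if and only if all
its geometric points do. -/
noncomputable def Gw0 (R : Type u) [CommRing R] : Subgroup (Amb R) where
  carrier := {g | g ∈ Gw R ∧ ∀ (K : Type u) [Field K] [IsAlgClosed K] (φ : R →+* K),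
    Amb.map φ g ∈ component K}
  one_mem' := ⟨one_mem _, fun K _ _ φ => by rw [map_one]; exact one_mem_component K⟩
  mul_mem' := fun {g h} hg hh => ⟨mul_mem hg.1 hh.1, fun K _ _ φ => by
    rw [map_mul]; exact mul_mem_component (hg.2 K φ) (hh.2 K φ)⟩
  inv_mem' := fun {g} hg => ⟨inv_mem hg.1, fun K _ _ φ => by
    rw [map_inv]; exact inv_mem_component (hg.2 K φ)⟩

/-! ### The embedding of `GL(2)`, the scalars and `τ` -/

/-- The block diagonal matrix with blocks `1, δ', A, δ, ᵗB`. -/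
def blockMatrix {R : Type u} [CommRing R] (δ δ' : R) (A B : Matrix (Fin 2) (Fin 2) R) :
    Matrix (Fin 7) (Fin 7) R :=
  !![1, 0, 0, 0, 0, 0, 0;
     0, δ', 0, 0, 0, 0, 0;
     0, 0, A 0 0, A 0 1, 0, 0, 0;
     0, 0, A 1 0, A 1 1, 0, 0, 0;
     0, 0, 0, 0, δ, 0, 0;
     0, 0, 0, 0, 0, B 0 0, B 1 0;
     0, 0, 0, 0, 0, B 0 1, B 1 1]

theorem blockMatrix_mul {R : Type u} [CommRing R] (δ δ' ε ε' : R)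
    (A B C D : Matrix (Fin 2) (Fin 2) R) (h1 : δ * ε = 1) (h2 : δ' * ε' = 1)
    (h3 : A * C = 1) (h4 : D * B = 1) :
    blockMatrix δ δ' A B * blockMatrix ε ε' C D = 1 := by
  have a00 := congrFun (congrFun h3 0) 0
  have a01 := congrFun (congrFun h3 0) 1
  have a10 := congrFun (congrFun h3 1) 0
  have a11 := congrFun (congrFun h3 1) 1
  have b00 := congrFun (congrFun h4 0) 0
  have b01 := congrFun (congrFun h4 0) 1
  have b10 := congrFun (congrFun h4 1) 0
  have b11 := congrFun (congrFun h4 1) 1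
  simp [Matrix.mul_apply, Fin.sum_univ_two] at a00 a01 a10 a11 b00 b01 b10 b11
  ext i j
  fin_cases i <;> fin_cases j <;>
    simp [blockMatrix, Matrix.mul_apply, Fin.sum_univ_succ] <;> grind

/-- `d₁(A)`, block diagonal with blocks `1, (det A)⁻¹, A, det A, ᵗA⁻¹`. -/
def d₁ {R : Type u} [CommRing R] (A : Matrix.GeneralLinearGroup (Fin 2) R) :
    Matrix.GeneralLinearGroup (Fin 7) R where
  val := blockMatrix ((Matrix.GeneralLinearGroup.det A : Rˣ) : R)
    (((Matrix.GeneralLinearGroup.det A)⁻¹ : Rˣ) : R)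
    (A : Matrix (Fin 2) (Fin 2) R) ((A⁻¹ : Matrix.GeneralLinearGroup (Fin 2) R) : Matrix _ _ R)
  inv := blockMatrix (((Matrix.GeneralLinearGroup.det A)⁻¹ : Rˣ) : R)
    ((Matrix.GeneralLinearGroup.det A : Rˣ) : R)
    ((A⁻¹ : Matrix.GeneralLinearGroup (Fin 2) R) : Matrix _ _ R) (A : Matrix (Fin 2) (Fin 2) R)
  val_inv := blockMatrix_mul _ _ _ _ _ _ _ _ (Units.mul_inv _) (Units.inv_mul _)
    (Units.mul_inv A) (Units.mul_inv A)
  inv_val := blockMatrix_mul _ _ _ _ _ _ _ _ (Units.inv_mul _) (Units.mul_inv _)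
    (Units.inv_mul A) (Units.inv_mul A)

/-- The diagonal matrix `diag(a, b)` in `GL(2)`. -/
def diag₂ {R : Type u} [CommRing R] (a b : Rˣ) : Matrix.GeneralLinearGroup (Fin 2) R where
  val := !![(a : R), 0; 0, (b : R)]
  inv := !![((a⁻¹ : Rˣ) : R), 0; 0, ((b⁻¹ : Rˣ) : R)]
  val_inv := by simp [Matrix.one_fin_two]
  inv_val := by simp [Matrix.one_fin_two]

/-- `d(A) = (d₁(A), d₂(A))` with `d₂(A) = diag(det A, (det A)⁻¹)`. -/
def d {R : Type u} [CommRing R] (A : Matrix.GeneralLinearGroup (Fin 2) R) : Amb R :=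
  (d₁ A, diag₂ (Matrix.GeneralLinearGroup.det A) (Matrix.GeneralLinearGroup.det A)⁻¹)

/-- `(t⁻¹ I₇, t I₂)`. -/
def scal {R : Type u} [CommRing R] (t : Rˣ) : Amb R :=
  (Matrix.GeneralLinearGroup.scalar (Fin 7) t⁻¹, Matrix.GeneralLinearGroup.scalar (Fin 2) t)

/-- `τ₁`, with blocks `1`; `1` exchanging `e₂, e₅`; and `Λ = diag(1, -1)` exchanging
`⟨e₃, e₄⟩` and `⟨e₆, e₇⟩`. -/
def τ₁Matrix (R : Type u) [CommRing R] : Matrix (Fin 7) (Fin 7) R :=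
  !![1, 0, 0, 0, 0, 0, 0;
     0, 0, 0, 0, 1, 0, 0;
     0, 0, 0, 0, 0, 1, 0;
     0, 0, 0, 0, 0, 0, -1;
     0, 1, 0, 0, 0, 0, 0;
     0, 0, 1, 0, 0, 0, 0;
     0, 0, 0, -1, 0, 0, 0]

theorem τ₁Matrix_sq (R : Type u) [CommRing R] : τ₁Matrix R * τ₁Matrix R = 1 := by
  ext i j
  fin_cases i <;> fin_cases j <;> simp [τ₁Matrix, Matrix.mul_apply, Fin.sum_univ_succ]

theorem τ₂Matrix_sq (R : Type u) [CommRing R] :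
    (!![0, 1; 1, 0] : Matrix (Fin 2) (Fin 2) R) * !![0, 1; 1, 0] = 1 := by
  simp [Matrix.one_fin_two]

/-- `τ = (τ₁, τ₂)`, where `τ₂` exchanges the two coordinates. -/
def τ (R : Type u) [CommRing R] : Amb R :=
  (⟨τ₁Matrix R, τ₁Matrix R, τ₁Matrix_sq R, τ₁Matrix_sq R⟩,
    ⟨!![0, 1; 1, 0], !![0, 1; 1, 0], τ₂Matrix_sq R, τ₂Matrix_sq R⟩)

/-! ### The constant group `ℤ/2` -/

/-- The `R`-points of the constant group scheme `ℤ/2`: locally constant functions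
`Spec R → ℤ/2` (the group `ℤ/2` being written multiplicatively). -/
abbrev Z2 (R : Type u) [CommRing R] : Type u :=
  LocallyConstant (PrimeSpectrum R) (Multiplicative (ZMod 2))

/-- Extension of scalars for the constant group scheme `ℤ/2`. -/
noncomputable def Z2.map {R S : Type u} [CommRing R] [CommRing S] (φ : R →+* S) :
    Z2 R →* Z2 S :=
  LocallyConstant.comapMonoidHom ⟨PrimeSpectrum.comap φ, PrimeSpectrum.continuous_comap φ⟩

/-- The non-trivial element of `ℤ/2`. -/
def Z2.gen (R : Type u) [CommRing R] : Z2 R :=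
  LocallyConstant.const _ (Multiplicative.ofAdd 1)

end CaseTwo

/-! ### Trivectors in coordinates: the conditions defining `G₁` and `Gw` as equations -/

namespace CaseTwo

/-! Read `w̄` as an alternating form on covectors (`triForm`): the coordinates of `g w̄` are its
values on triples of rows of `g`. The conditions on a pair (M, N) in GL(7) × GL(2) become polynomial
equations, which can be solved over every ring where 2 is a unit. Matrix indices below are
zero-based.

Fixing `w` means that M preserves ⟨e₂, e₅⟩ and that N is the inverse transpose of the block of M
there. Modulo ⟨e₂, e₅⟩ the trivector is e₁ ∧ ω with ω = e₃₆ + e₄₇, which forces M e₁ into ⟨e₁, e₂,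
e₅⟩ (`IsSim.col0`), so M acts by a 4 × 4 matrix H on the quotient by this space. Contracting `w̄`
with a covector x gives the bivector x₀ω + x₁e₃₄ + x₄e₆₇ on that quotient, whose wedge square is
2(x₁x₄ - x₀²)e₃₄₆₇. Hence M preserves this quadratic form up to a factor (`IsSim.pair_relations`),
and its 2 × 2 block on ⟨e₂, e₅⟩ has products M₁₁M₁₄ = M₄₁M₄₄ = 0 and permanent M₀₀². The remaining
entries of rows 0, 1, 4 vanish (`IsSim.rows_eq_zero`).

It follows that `idem` = N₀₀N₁₁/det N is idempotent on `Gw`. Where it is 1, N is diagonal, M is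
block diagonal and the pair is some d(A)·(t⁻¹I₇, tI₂) (`exists_eq_d_mul_scal`); where it is 0,
multiplication by `τ` leads back to that case. Idempotents of R are the R-points of ℤ/2, which gives
the projection, and ε ↦ ε + (1 - ε)τ gives the section.

For the identity component, `idem` separates `Gw` over a field into two disjoint open pieces, and
the piece through 1 is the image of GL(2) × GL(1), irreducible because that group is the locus t det
A ≠ 0 in an affine space (`component_eq`). Over a ring, `idem` is tested at geometric points
(`mem_Gw0_iff`). -/

/-- The determinant of the columns `a, b, c` of the matrix with rows `x, y, z`. -/
def minor3 {R : Type u} [CommRing R] (x y z : Fin 7 → R) (a b c : Fin 7) : R :=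
  x a * (y b * z c - y c * z b) - x b * (y a * z c - y c * z a) + x c * (y a * z b - y b * z a)

/-- The value of `w̄` as an alternating form on triples of covectors. -/
def triForm {R : Type u} [CommRing R] (x y z : Fin 7 → R) : R :=
  minor3 x y z 1 2 3 + minor3 x y z 4 5 6 +
    (minor3 x y z 0 1 4 + minor3 x y z 0 2 5 + minor3 x y z 0 3 6)

/-- Evaluation of a trivector on three coordinate functions. -/
noncomputable def coordEval (R : Type u) [CommRing R] (i j l : Fin 7) :
    ⋀[R]^3 (Fin 7 → R) →ₗ[R] R :=
  exteriorPower.alternatingMapToDual R (Fin 7 → R) 3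
    ![LinearMap.proj i, LinearMap.proj j, LinearMap.proj l]

theorem coordEval_wedgeAct_e3 {R : Type u} [CommRing R] (g : Matrix.GeneralLinearGroup (Fin 7) R)
    (i j l a b c : Fin 7) :
    coordEval R i j l (wedgeAct g (e3 R a b c)) =
      minor3 ((g : Matrix (Fin 7) (Fin 7) R) i) ((g : Matrix (Fin 7) (Fin 7) R) j)
        ((g : Matrix (Fin 7) (Fin 7) R) l) a b c := by
  rw [coordEval, wedgeAct, e3, exteriorPower.map_apply_ιMulti,
    exteriorPower.alternatingMapToDual_apply_ιMulti, Matrix.det_fin_three]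
  simp [e, minor3]
  ring

theorem coordEval_wedgeAct_wBar {R : Type u} [CommRing R]
    (g : Matrix.GeneralLinearGroup (Fin 7) R) (i j l : Fin 7) :
    coordEval R i j l (wedgeAct g (wBar R)) =
      triForm ((g : Matrix (Fin 7) (Fin 7) R) i) ((g : Matrix (Fin 7) (Fin 7) R) j)
        ((g : Matrix (Fin 7) (Fin 7) R) l) := by
  simp only [wBar, map_add, coordEval_wedgeAct_e3, triForm]

theorem wedgeAct_one {R : Type u} [CommRing R] (x : ⋀[R]^3 (Fin 7 → R)) :
    wedgeAct 1 x = x := by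
  simp [wedgeAct]

theorem coordEval_wBar {R : Type u} [CommRing R] (i j l : Fin 7) :
    coordEval R i j l (wBar R) = triForm (e R i) (e R j) (e R l) := by
  have h (i : Fin 7) : e R i = (1 : Matrix (Fin 7) (Fin 7) R) i := by
    funext j
    simp [e, Matrix.one_apply, Pi.single_apply, eq_comm]
  rw [h, h, h, ← wedgeAct_one (wBar R), coordEval_wedgeAct_wBar]
  simp

theorem trivector_ext {R : Type u} [CommRing R] {x y : ⋀[R]^3 (Fin 7 → R)}
    (h : ∀ i j l : Fin 7, i < j → j < l → coordEval R i j l x = coordEval R i j l y) : x = y := by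
  apply ((Pi.basisFun R (Fin 7)).exteriorPower 3).repr.injective
  ext s
  rw [exteriorPower.basis_repr_apply, exteriorPower.basis_repr_apply]
  -- The dual basis vector attached to a three-element set s evaluates a trivector on the elements
  -- of s in increasing order.
  have key : exteriorPower.ιMultiDual R 3 (Pi.basisFun R (Fin 7)) s =
      coordEval R (Set.powersetCard.ofFinEmbEquiv.symm s 0)
        (Set.powersetCard.ofFinEmbEquiv.symm s 1) (Set.powersetCard.ofFinEmbEquiv.symm s 2) := by
    apply exteriorPower.linearMap_ext
    ext v
    simp only [LinearMap.compAlternatingMap_apply, exteriorPower.ιMultiDual_apply_ιMulti,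
      coordEval, exteriorPower.alternatingMapToDual_apply_ιMulti]
    congr 2
    funext i j
    fin_cases j <;> simp
  rw [key]
  apply h <;> simp

theorem mem_G₁_iff {R : Type u} [CommRing R] {g : Matrix.GeneralLinearGroup (Fin 7) R} :
    g ∈ G₁ R ↔ ∃ c : Rˣ, ∀ i j l : Fin 7, i < j → j < l →
      triForm ((g : Matrix (Fin 7) (Fin 7) R) i) ((g : Matrix (Fin 7) (Fin 7) R) j)
        ((g : Matrix (Fin 7) (Fin 7) R) l) = c * triForm (e R i) (e R j) (e R l) := by
  refine exists_congr fun c => ⟨fun h i j l _ _ => ?_, fun h => trivector_ext fun i j l hi hj => ?_⟩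
  · rw [← coordEval_wedgeAct_wBar, h, map_smul, coordEval_wBar, smul_eq_mul]
  · rw [coordEval_wedgeAct_wBar, h i j l hi hj, map_smul, coordEval_wBar, smul_eq_mul]

theorem act_w_eq_iff {R : Type u} [CommRing R] (g : Amb R) :
    act g (w R) = w R ↔ ∀ (a : Fin 2) (i : Fin 7),
      (g.2 : Matrix (Fin 2) (Fin 2) R) a 0 * (g.1 : Matrix (Fin 7) (Fin 7) R) i 1 +
        (g.2 : Matrix (Fin 2) (Fin 2) R) a 1 * (g.1 : Matrix (Fin 7) (Fin 7) R) i 4 =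
      (1 : Matrix (Fin 2) (Fin 2) R) a 0 * (1 : Matrix (Fin 7) (Fin 7) R) i 1 +
        (1 : Matrix (Fin 2) (Fin 2) R) a 1 * (1 : Matrix (Fin 7) (Fin 7) R) i 4 := by
  have h (a : Fin 2) (i : Fin 7) (g : Amb R) : act g (w R) (Pi.single a 1) i =
      (g.2 : Matrix (Fin 2) (Fin 2) R) a 0 * (g.1 : Matrix (Fin 7) (Fin 7) R) i 1 +
        (g.2 : Matrix (Fin 2) (Fin 2) R) a 1 * (g.1 : Matrix (Fin 7) (Fin 7) R) i 4 := by
    simp [act_apply, w, e, Matrix.mulVec_add, Matrix.mulVec_smul]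
  -- The case g = 1 writes `w` itself in the same coordinates.
  have h1 (a : Fin 2) (i : Fin 7) := h a i 1
  rw [act_one] at h1
  simp only [Prod.fst_one, Prod.snd_one, Units.val_one] at h1
  constructor
  · intro H a i
    rw [← h, ← h1, H]
  · intro H
    refine (Pi.basisFun R (Fin 2)).ext fun a => funext fun i => ?_
    rw [Pi.basisFun_apply, h, h1, H]

/-! ### Exterior algebra identities in coordinates -/

/-- Covectors that annihilate e₂ and e₅ see only e₁ ∧ ω in `w̄`, where ω = e₃₆ + e₄₇; this is e₁ ∧
(e₁ ∧ ω) = 0 evaluated on four of them. -/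
theorem triForm_first_col {R : Type u} [CommRing R] {x y z t : Fin 7 → R}
    (hx1 : x 1 = 0) (hx4 : x 4 = 0) (hy1 : y 1 = 0) (hy4 : y 4 = 0) (hz1 : z 1 = 0)
    (hz4 : z 4 = 0) (ht1 : t 1 = 0) (ht4 : t 4 = 0) :
    x 0 * triForm y z t - y 0 * triForm x z t + z 0 * triForm x y t - t 0 * triForm x y z = 0 := by
  simp only [triForm, minor3, hx1, hx4, hy1, hy4, hz1, hz4, ht1, ht4]
  ring

/-- The form `e₃ ∧ e₆ + e₄ ∧ e₇` on covectors. -/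
def symp {R : Type u} [CommRing R] (x y : Fin 7 → R) : R :=
  x 2 * y 5 - x 5 * y 2 + (x 3 * y 6 - x 6 * y 3)

/-- The minor of the columns `a, b` of the matrix with rows `x, y`. -/
def minor2 {R : Type u} [CommRing R] (x y : Fin 7 → R) (a b : Fin 7) : R :=
  x a * y b - x b * y a

/-- The determinant of the columns `3, 4, 6, 7` of four covectors, by Laplace expansion. -/
def lap {R : Type u} [CommRing R] (x y z t : Fin 7 → R) : R :=
  minor2 x y 2 3 * minor2 z t 5 6 - minor2 x z 2 3 * minor2 y t 5 6
    + minor2 x t 2 3 * minor2 y z 5 6 + minor2 y z 2 3 * minor2 x t 5 6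
    - minor2 y t 2 3 * minor2 x z 5 6 + minor2 z t 2 3 * minor2 x y 5 6

/-- The left side is η ∧ θ on four covectors. Among the products of ω, e₃₄, e₆₇ only e₃₄ ∧ e₆₇ =
e₃₄₆₇ and ω ∧ ω = -2e₃₄₆₇ survive. -/
theorem lap_pairing {R : Type u} [CommRing R] (x y z t : Fin 7 → R) (a p q b s r : R)
    (η θ : (Fin 7 → R) → (Fin 7 → R) → R)
    (hη : ∀ v w, η v w = a * symp v w + p * minor2 v w 2 3 + q * minor2 v w 5 6)
    (hθ : ∀ v w, θ v w = b * symp v w + s * minor2 v w 2 3 + r * minor2 v w 5 6) :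
    η x y * θ z t - η x z * θ y t + η x t * θ y z + η y z * θ x t - η y t * θ x z
      + η z t * θ x y = (p * r + q * s - 2 * (a * b)) * lap x y z t := by
  simp only [hη, hθ, symp, minor2, lap]
  ring

/-- The matrix H of the four rows satisfies a·H J ᵗH = c·J for the standard symplectic J, so it is
invertible. -/
theorem eq_zero_of_symp {R : Type u} [CommRing R] {x y z t : Fin 7 → R} {a : R} {c : Rˣ}
    (hxy : a * symp x y = 0) (hxz : a * symp x z = c) (hxt : a * symp x t = 0)
    (hyz : a * symp y z = 0) (hyt : a * symp y t = c) (hzt : a * symp z t = 0)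
    {f₂ f₃ f₅ f₆ : R} (hx : x 2 * f₂ + x 3 * f₃ + x 5 * f₅ + x 6 * f₆ = 0)
    (hy : y 2 * f₂ + y 3 * f₃ + y 5 * f₅ + y 6 * f₆ = 0)
    (hz : z 2 * f₂ + z 3 * f₃ + z 5 * f₅ + z 6 * f₆ = 0)
    (ht : t 2 * f₂ + t 3 * f₃ + t 5 * f₅ + t 6 * f₆ = 0) :
    f₂ = 0 ∧ f₃ = 0 ∧ f₅ = 0 ∧ f₆ = 0 := by
  obtain ⟨ci, hc⟩ : ∃ ci : R, (c : R) * ci = 1 := ⟨_, c.mul_inv⟩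
  simp only [symp] at hxy hxz hxt hyz hyt hzt
  let H : Matrix (Fin 4) (Fin 4) R := !![x 2, x 3, x 5, x 6; y 2, y 3, y 5, y 6;
    z 2, z 3, z 5, z 6; t 2, t 3, t 5, t 6]
  -- The symplectic adjoint of H, scaled by c⁻¹a. It is a right inverse, hence also a left inverse.
  let K : Matrix (Fin 4) (Fin 4) R := (ci * a) •
    !![z 5, t 5, -x 5, -y 5; z 6, t 6, -x 6, -y 6; -z 2, -t 2, x 2, y 2; -z 3, -t 3, x 3, y 3]
  have hK : H * K = 1 := by
    ext i j
    fin_cases i <;> fin_cases j <;> simp [H, K, Matrix.mul_apply, Fin.sum_univ_four]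
    · linear_combination ci * hxz + hc
    · linear_combination ci * hxt
    · ring
    · linear_combination -ci * hxy
    · linear_combination ci * hyz
    · linear_combination ci * hyt + hc
    · linear_combination ci * hxy
    · ring
    · ring
    · linear_combination ci * hzt
    · linear_combination ci * hxz + hc
    · linear_combination ci * hyz
    · linear_combination -ci * hzt
    · ring
    · linear_combination ci * hxt
    · linear_combination ci * hyt + hc
  have hKH := mul_eq_one_comm.1 hK
  have hf : H *ᵥ ![f₂, f₃, f₅, f₆] = 0 := by
    funext i
    fin_cases i <;> simp [H, Matrix.mulVec, dotProduct, Fin.sum_univ_four, hx, hy, hz, ht]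
  have h0 : ![f₂, f₃, f₅, f₆] = 0 := by
    rw [← Matrix.one_mulVec ![f₂, f₃, f₅, f₆], ← hKH, ← Matrix.mulVec_mulVec, hf,
      Matrix.mulVec_zero]
  exact ⟨congrFun h0 0, congrFun h0 1, congrFun h0 2, congrFun h0 3⟩

/-! ### Similitudes of `w̄` that preserve ⟨e₂, e₅⟩ -/

section

theorem triForm_swap {R : Type u} [CommRing R] (x y z : Fin 7 → R) : triForm x y z = - triForm y x z := by
  simp only [triForm, minor3]; ring

theorem triForm_rotate {R : Type u} [CommRing R] (x y z : Fin 7 → R) : triForm x y z = triForm z x y := by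
  simp only [triForm, minor3]; ring

theorem triForm_self {R : Type u} [CommRing R] (x y : Fin 7 → R) : triForm x x y = 0 := by
  simp only [triForm, minor3]; ring

/-- The rows of `M` transform `w̄` into `c w̄`, and `M` preserves `⟨e₂, e₅⟩`. -/
structure IsSim {R : Type u} [CommRing R] (M : Matrix (Fin 7) (Fin 7) R) (c : Rˣ) : Prop where
  tri : ∀ i j l : Fin 7, i < j → j < l →
      triForm (M i) (M j) (M l) = c * triForm (e R i) (e R j) (e R l)
  col1 : ∀ i, i ≠ 1 → i ≠ 4 → M i 1 = 0
  col4 : ∀ i, i ≠ 1 → i ≠ 4 → M i 4 = 0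

namespace IsSim

variable {R : Type u} [CommRing R] {M : Matrix (Fin 7) (Fin 7) R} {c : Rˣ}

theorem tri_all (h : IsSim M c) (i j l : Fin 7) :
    triForm (M i) (M j) (M l) = c * triForm (e R i) (e R j) (e R l) := by
  have cyc {i j l : Fin 7} (hl : l < i) (hij : i < j) :
      triForm (M i) (M j) (M l) = c * triForm (e R i) (e R j) (e R l) := by
    rw [triForm_rotate, h.tri l i j hl hij, triForm_rotate (e R i)]
  have lt {i j : Fin 7} (hij : i < j) (l : Fin 7) :
      triForm (M i) (M j) (M l) = c * triForm (e R i) (e R j) (e R l) := by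
    rcases lt_trichotomy j l with hjl | rfl | hjl
    · exact h.tri i j l hij hjl
    · rw [triForm_rotate, triForm_rotate, triForm_self, triForm_rotate, triForm_rotate,
        triForm_self, mul_zero]
    · rcases lt_trichotomy i l with hil | rfl | hil
      · rw [triForm_rotate, triForm_swap, h.tri i l j hil hjl, triForm_rotate (e R i),
          triForm_swap (e R j), mul_neg, neg_neg]
      · rw [triForm_rotate, triForm_self, triForm_rotate, triForm_self, mul_zero]
      · exact cyc hil hij
  rcases lt_trichotomy i j with hij | rfl | hij
  · exact lt hij l
  · rw [triForm_self, triForm_self, mul_zero]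
  · rw [triForm_swap, lt hij, triForm_swap (e R j), mul_neg, neg_neg]

theorem first_col_relation (h : IsSim M c) {i j l m : Fin 7} (hij : i < j) (hjl : j < l)
    (hlm : l < m) (hi : i ≠ 1 ∧ i ≠ 4) (hj : j ≠ 1 ∧ j ≠ 4) (hl : l ≠ 1 ∧ l ≠ 4)
    (hm : m ≠ 1 ∧ m ≠ 4) :
    M i 0 * triForm (e R j) (e R l) (e R m) - M j 0 * triForm (e R i) (e R l) (e R m) +
      M l 0 * triForm (e R i) (e R j) (e R m) - M m 0 * triForm (e R i) (e R j) (e R l) = 0 := by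
  have key := triForm_first_col
    (h.col1 i hi.1 hi.2) (h.col4 i hi.1 hi.2) (h.col1 j hj.1 hj.2) (h.col4 j hj.1 hj.2)
    (h.col1 l hl.1 hl.2) (h.col4 l hl.1 hl.2) (h.col1 m hm.1 hm.2) (h.col4 m hm.1 hm.2)
  rw [h.tri j l m hjl hlm, h.tri i l m (hij.trans hjl) hlm, h.tri i j m hij (hjl.trans hlm),
    h.tri i j l hij hjl] at key
  refine c.isUnit.mul_left_cancel ?_
  linear_combination key

/-- Each relation uses row 0, the row to be treated, and whichever of the symplectic pairs {2, 5},
{3, 6} avoids that row. Row 0 with the pair is the only triple among the four rows on which `w̄` is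
nonzero, so a single term is left. -/
theorem col0 (h : IsSim M c) : ∀ i, i ≠ 0 → i ≠ 1 → i ≠ 4 → M i 0 = 0 := by
  have h2 := h.first_col_relation (i := 0) (j := 2) (l := 3) (m := 6)
    (by decide) (by decide) (by decide) (by decide) (by decide) (by decide) (by decide)
  have h3 := h.first_col_relation (i := 0) (j := 2) (l := 3) (m := 5)
    (by decide) (by decide) (by decide) (by decide) (by decide) (by decide) (by decide)
  have h5 := h.first_col_relation (i := 0) (j := 3) (l := 5) (m := 6)
    (by decide) (by decide) (by decide) (by decide) (by decide) (by decide) (by decide)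
  have h6 := h.first_col_relation (i := 0) (j := 2) (l := 5) (m := 6)
    (by decide) (by decide) (by decide) (by decide) (by decide) (by decide) (by decide)
  simp [triForm, minor3, e] at h2 h3 h5 h6
  intro i h0 h1 h4
  fin_cases i <;> simp_all

/-- The contraction of `w̄` with a covector `x`, on the rows spanning `⟨e³, e⁴, e⁶, e⁷⟩`. -/
theorem triForm_eq (h : IsSim M c) (x : Fin 7 → R) {i j : Fin 7}
    (hi : i ≠ 0 ∧ i ≠ 1 ∧ i ≠ 4) (hj : j ≠ 0 ∧ j ≠ 1 ∧ j ≠ 4) :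
    triForm x (M i) (M j) = x 0 * symp (M i) (M j) + x 1 * minor2 (M i) (M j) 2 3 +
      x 4 * minor2 (M i) (M j) 5 6 := by
  simp only [triForm, minor3, symp, minor2, h.col0 i hi.1 hi.2.1 hi.2.2,
    h.col0 j hj.1 hj.2.1 hj.2.2, h.col1 i hi.2.1 hi.2.2, h.col1 j hj.2.1 hj.2.2,
    h.col4 i hi.2.1 hi.2.2, h.col4 j hj.2.1 hj.2.2]
  ring

theorem triForm_row0 (h : IsSim M c) (i j : Fin 7)
    (hi : i ≠ 0 ∧ i ≠ 1 ∧ i ≠ 4) (hj : j ≠ 0 ∧ j ≠ 1 ∧ j ≠ 4) :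
    M 0 0 * symp (M i) (M j) = c * triForm (e R 0) (e R i) (e R j) := by
  rw [← h.tri_all 0 i j, h.triForm_eq _ hi hj,
    h.col1 0 (by decide) (by decide), h.col4 0 (by decide) (by decide)]
  ring

theorem triForm_row1 (h : IsSim M c) (i j : Fin 7)
    (hi : i ≠ 0 ∧ i ≠ 1 ∧ i ≠ 4) (hj : j ≠ 0 ∧ j ≠ 1 ∧ j ≠ 4) :
    M 1 0 * symp (M i) (M j) + M 1 1 * minor2 (M i) (M j) 2 3 + M 1 4 * minor2 (M i) (M j) 5 6
      = c * triForm (e R 1) (e R i) (e R j) := by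
  rw [← h.tri_all 1 i j, h.triForm_eq _ hi hj]

theorem triForm_row4 (h : IsSim M c) (i j : Fin 7)
    (hi : i ≠ 0 ∧ i ≠ 1 ∧ i ≠ 4) (hj : j ≠ 0 ∧ j ≠ 1 ∧ j ≠ 4) :
    M 4 0 * symp (M i) (M j) + M 4 1 * minor2 (M i) (M j) 2 3 + M 4 4 * minor2 (M i) (M j) 5 6
      = c * triForm (e R 4) (e R i) (e R j) := by
  rw [← h.tri_all 4 i j, h.triForm_eq _ hi hj]

end IsSim

end

/-! ### The invariant quadratic form and the shape of rows 0, 1, 4 -/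

section

namespace IsSim

variable {R : Type u} [CommRing R] {M : Matrix (Fin 7) (Fin 7) R} {c : Rˣ}

/-- On rows 2, 3, 5, 6 the contractions of `w̄` with rows 0, 1, 4 take c times the values of ω, e₃₄,
e₆₇. Computing their wedge products both from these values and by `lap_pairing` compares the
quadratic form 2(x₁x₄ - x₀²) with its transform. -/
theorem pair_relations (h : IsSim M c) :
    2 * (M 0 0 * M 0 0) * lap (M 2) (M 3) (M 5) (M 6) = 2 * (c * c) ∧
    2 * (M 0 0 * M 1 0) * lap (M 2) (M 3) (M 5) (M 6) = 0 ∧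
    2 * (M 0 0 * M 4 0) * lap (M 2) (M 3) (M 5) (M 6) = 0 ∧
    (2 * (M 1 1 * M 1 4) - 2 * (M 1 0 * M 1 0)) * lap (M 2) (M 3) (M 5) (M 6) = 0 ∧
    (2 * (M 4 1 * M 4 4) - 2 * (M 4 0 * M 4 0)) * lap (M 2) (M 3) (M 5) (M 6) = 0 ∧
    (M 1 1 * M 4 4 + M 1 4 * M 4 1 - 2 * (M 1 0 * M 4 0)) * lap (M 2) (M 3) (M 5) (M 6)
      = c * c := by
  have r0 := h.triForm_row0
  have r1 := h.triForm_row1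
  have r4 := h.triForm_row4
  have t (a p q b s r : R) := lap_pairing (M 2) (M 3) (M 5) (M 6) a p q b s r _ _
    (fun _ _ => rfl) (fun _ _ => rfl)
  have t00 := t (M 0 0) 0 0 (M 0 0) 0 0
  have t01 := t (M 0 0) 0 0 (M 1 0) (M 1 1) (M 1 4)
  have t04 := t (M 0 0) 0 0 (M 4 0) (M 4 1) (M 4 4)
  have t11 := t (M 1 0) (M 1 1) (M 1 4) (M 1 0) (M 1 1) (M 1 4)
  have t44 := t (M 4 0) (M 4 1) (M 4 4) (M 4 0) (M 4 1) (M 4 4)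
  have t14 := t (M 1 0) (M 1 1) (M 1 4) (M 4 0) (M 4 1) (M 4 4)
  simp only [zero_mul, add_zero] at t00 t01 t04
  rw [r0 2 3 (by decide) (by decide), r0 2 5 (by decide) (by decide),
    r0 2 6 (by decide) (by decide), r0 3 5 (by decide) (by decide),
    r0 3 6 (by decide) (by decide), r0 5 6 (by decide) (by decide)]
    at t00 t01 t04
  rw [r1 2 3 (by decide) (by decide), r1 2 5 (by decide) (by decide),
    r1 2 6 (by decide) (by decide), r1 3 5 (by decide) (by decide),
    r1 3 6 (by decide) (by decide), r1 5 6 (by decide) (by decide)]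
    at t01 t11 t14
  rw [r4 2 3 (by decide) (by decide), r4 2 5 (by decide) (by decide),
    r4 2 6 (by decide) (by decide), r4 3 5 (by decide) (by decide),
    r4 3 6 (by decide) (by decide), r4 5 6 (by decide) (by decide)]
    at t04 t44 t14
  simp only [triForm, minor3, e, Pi.single_apply, Fin.isValue, Fin.reduceEq, if_true, if_false,
    mul_zero, zero_mul, mul_one, sub_zero, zero_sub, add_zero, zero_add]
    at t00 t01 t04 t11 t44 t14
  refine ⟨?_, ?_, ?_, ?_, ?_, ?_⟩
  · linear_combination t00
  · linear_combination t01
  · linear_combination t04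
  · linear_combination -t11
  · linear_combination -t44
  · linear_combination -t14

theorem lap_isUnit (h : IsSim M c) (h2 : IsUnit (2 : R)) :
    IsUnit (lap (M 2) (M 3) (M 5) (M 6)) := by
  refine isUnit_of_mul_isUnit_right (x := 2 * (M 0 0 * M 0 0)) ?_
  rw [h.pair_relations.1]
  exact h2.mul (c.isUnit.mul c.isUnit)

theorem isUnit_zero_zero (h : IsSim M c) (h2 : IsUnit (2 : R)) : IsUnit (M 0 0) := by
  refine isUnit_of_mul_isUnit_left (y := 2 * M 0 0 * lap (M 2) (M 3) (M 5) (M 6)) ?_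
  rw [show M 0 0 * (2 * M 0 0 * lap (M 2) (M 3) (M 5) (M 6)) =
    2 * (M 0 0 * M 0 0) * lap (M 2) (M 3) (M 5) (M 6) by ring, h.pair_relations.1]
  exact h2.mul (c.isUnit.mul c.isUnit)

theorem one_zero (h : IsSim M c) (h2 : IsUnit (2 : R)) : M 1 0 = 0 := by
  refine ((h2.mul (h.isUnit_zero_zero h2)).mul (h.lap_isUnit h2)).mul_left_cancel ?_
  linear_combination h.pair_relations.2.1

theorem four_zero (h : IsSim M c) (h2 : IsUnit (2 : R)) : M 4 0 = 0 := by
  refine ((h2.mul (h.isUnit_zero_zero h2)).mul (h.lap_isUnit h2)).mul_left_cancel ?_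
  linear_combination h.pair_relations.2.2.1

theorem row1_mul (h : IsSim M c) (h2 : IsUnit (2 : R)) : M 1 1 * M 1 4 = 0 := by
  refine (h2.mul (h.lap_isUnit h2)).mul_left_cancel ?_
  have := h.pair_relations.2.2.2.1
  rw [h.one_zero h2] at this
  linear_combination this

theorem row4_mul (h : IsSim M c) (h2 : IsUnit (2 : R)) : M 4 1 * M 4 4 = 0 := by
  refine (h2.mul (h.lap_isUnit h2)).mul_left_cancel ?_
  have := h.pair_relations.2.2.2.2.1
  rw [h.four_zero h2] at this
  linear_combination this

theorem permanent_eq (h : IsSim M c) (h2 : IsUnit (2 : R)) :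
    M 1 1 * M 4 4 + M 1 4 * M 4 1 = M 0 0 * M 0 0 := by
  refine (h2.mul (h.lap_isUnit h2)).mul_left_cancel ?_
  have := h.pair_relations.2.2.2.2.2
  rw [h.four_zero h2] at this
  linear_combination 2 * this - h.pair_relations.1

theorem isUnit_det (h : IsSim M c) (h2 : IsUnit (2 : R)) :
    IsUnit (M 1 1 * M 4 4 - M 1 4 * M 4 1) := by
  refine isUnit_of_mul_isUnit_left (y := M 1 1 * M 4 4 - M 1 4 * M 4 1) ?_
  have ha := h.isUnit_zero_zero h2
  have : (M 1 1 * M 4 4 - M 1 4 * M 4 1) * (M 1 1 * M 4 4 - M 1 4 * M 4 1) =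
      M 0 0 * M 0 0 * (M 0 0 * M 0 0) := by
    -- The squared determinant is the squared permanent minus four times the product of the four
    -- entries, and that product vanishes.
    linear_combination (M 1 1 * M 4 4 + M 1 4 * M 4 1 + M 0 0 * M 0 0) * h.permanent_eq h2 -
      4 * (M 4 1 * M 4 4) * h.row1_mul h2
  rw [this]
  exact (ha.mul ha).mul (ha.mul ha)

/-- Up to scalars, rows 2, 3, 5, 6 are a symplectic basis for `symp`, so a linear form vanishing on
them has zero coefficients. -/
theorem forms_eq_zero (h : IsSim M c) {f₂ f₃ f₅ f₆ : R}
    (hf : ∀ i, i ≠ 0 ∧ i ≠ 1 ∧ i ≠ 4 → M i 2 * f₂ + M i 3 * f₃ + M i 5 * f₅ + M i 6 * f₆ = 0) :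
    f₂ = 0 ∧ f₃ = 0 ∧ f₅ = 0 ∧ f₆ = 0 := by
  have r0 := h.triForm_row0
  refine eq_zero_of_symp (a := M 0 0) (c := c) (x := M 2) (y := M 3) (z := M 5) (t := M 6)
    ((r0 2 3 (by decide) (by decide)).trans ?_) ((r0 2 5 (by decide) (by decide)).trans ?_)
    ((r0 2 6 (by decide) (by decide)).trans ?_) ((r0 3 5 (by decide) (by decide)).trans ?_)
    ((r0 3 6 (by decide) (by decide)).trans ?_) ((r0 5 6 (by decide) (by decide)).trans ?_)
    (hf 2 (by decide)) (hf 3 (by decide)) (hf 5 (by decide)) (hf 6 (by decide)) <;>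
  simp [triForm, minor3, e]

theorem triForm_zero_left (h : IsSim M c) {y : Fin 7 → R} (hy : y 0 = 0) {i : Fin 7}
    (hi : i ≠ 0 ∧ i ≠ 1 ∧ i ≠ 4) :
    triForm (M 0) y (M i) = M i 2 * (y 1 * M 0 3 - M 0 0 * y 5) +
      M i 3 * (- (y 1 * M 0 2) - M 0 0 * y 6) + M i 5 * (M 0 0 * y 2 + y 4 * M 0 6) +
      M i 6 * (M 0 0 * y 3 - y 4 * M 0 5) := by
  simp only [triForm, minor3, h.col0 i hi.1 hi.2.1 hi.2.2, h.col1 i hi.2.1 hi.2.2,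
    h.col4 i hi.2.1 hi.2.2, h.col1 0 (by decide) (by decide), h.col4 0 (by decide) (by decide), hy]
  ring

theorem triForm_one_four (h : IsSim M c) {x y : Fin 7 → R} (hx : x 0 = 0) (hy : y 0 = 0)
    {i : Fin 7} (hi : i ≠ 0 ∧ i ≠ 1 ∧ i ≠ 4) :
    triForm x y (M i) = M i 2 * (y 1 * x 3 - x 1 * y 3) + M i 3 * (x 1 * y 2 - y 1 * x 2) +
      M i 5 * (y 4 * x 6 - x 4 * y 6) + M i 6 * (x 4 * y 5 - y 4 * x 5) := by
  simp only [triForm, minor3, h.col0 i hi.1 hi.2.1 hi.2.2, h.col1 i hi.2.1 hi.2.2,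
    h.col4 i hi.2.1 hi.2.2, hx, hy]
  ring

/-- `triForm` vanishes on two of the rows 0, 1, 4 together with a row i as here, and it is linear in
row i, so its coefficients vanish. The pairs (0, 1) and (0, 4) express M₀₀M₁ₖ and M₀₀M₄ₖ through row
0; substitution in the pair (1, 4) shows that row 0 is killed by the unit M₁₁M₄₄ - M₁₄M₄₁. -/
theorem rows_eq_zero (h : IsSim M c) (h2 : IsUnit (2 : R)) (i : Fin 7)
    (hi : i ≠ 0 ∧ i ≠ 1 ∧ i ≠ 4) : M 0 i = 0 ∧ M 1 i = 0 ∧ M 4 i = 0 := by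
  have e0 (j : Fin 7) (hj : j ≠ 0 ∧ j ≠ 1 ∧ j ≠ 4) :
      triForm (e R 0) (e R 1) (e R j) = 0 ∧ triForm (e R 0) (e R 4) (e R j) = 0 ∧
        triForm (e R 1) (e R 4) (e R j) = 0 := by
    obtain ⟨h0, h1, h4⟩ := hj
    fin_cases j <;> simp [triForm, minor3, e] at h0 h1 h4 ⊢
  obtain ⟨x2, x3, x5, x6⟩ := h.forms_eq_zero (fun j hj => by
    rw [← h.triForm_zero_left (h.one_zero h2) hj, h.tri_all, (e0 j hj).1, mul_zero])
  obtain ⟨y2, y3, y5, y6⟩ := h.forms_eq_zero (fun j hj => by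
    rw [← h.triForm_zero_left (h.four_zero h2) hj, h.tri_all, (e0 j hj).2.1, mul_zero])
  obtain ⟨z2, z3, z5, z6⟩ := h.forms_eq_zero (fun j hj => by
    rw [← h.triForm_one_four (h.one_zero h2) (h.four_zero h2) hj, h.tri_all, (e0 j hj).2.2,
      mul_zero])
  have hd := h.isUnit_det h2
  have ha := h.isUnit_zero_zero h2
  have m2 : M 0 2 = 0 := hd.mul_left_cancel (by
    linear_combination -M 0 0 * z5 - M 4 4 * x3 + M 1 4 * y3)
  have m3 : M 0 3 = 0 := hd.mul_left_cancel (by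
    linear_combination -M 0 0 * z6 + M 4 4 * x2 - M 1 4 * y2)
  have m5 : M 0 5 = 0 := hd.mul_left_cancel (by
    linear_combination -M 0 0 * z2 + M 4 1 * x6 - M 1 1 * y6)
  have m6 : M 0 6 = 0 := hd.mul_left_cancel (by
    linear_combination -M 0 0 * z3 - M 4 1 * x5 + M 1 1 * y5)
  rw [m2] at x3 y3
  rw [m3] at x2 y2
  rw [m5] at x6 y6
  rw [m6] at x5 y5
  have n (k : Fin 7) (hk : M 0 0 * M 1 k = 0) : M 1 k = 0 := (ha.mul_right_eq_zero).1 hk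
  have n4 (k : Fin 7) (hk : M 0 0 * M 4 k = 0) : M 4 k = 0 := (ha.mul_right_eq_zero).1 hk
  obtain ⟨h0, h1, h4⟩ := hi
  fin_cases i
  · exact absurd rfl h0
  · exact absurd rfl h1
  · exact ⟨m2, n 2 (by linear_combination x5), n4 2 (by linear_combination y5)⟩
  · exact ⟨m3, n 3 (by linear_combination x6), n4 3 (by linear_combination y6)⟩
  · exact absurd rfl h4
  · exact ⟨m5, n 5 (by linear_combination -x2), n4 5 (by linear_combination -y2)⟩
  · exact ⟨m6, n 6 (by linear_combination -x3), n4 6 (by linear_combination -y3)⟩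

theorem det_eq (h : IsSim M c) (h2 : IsUnit (2 : R)) :
    M 0 0 * (M 1 1 * M 4 4 - M 1 4 * M 4 1) = c := by
  have := h.tri 0 1 4 (by decide) (by decide)
  simp only [triForm, minor3, h.one_zero h2, h.four_zero h2, h.rows_eq_zero h2 2 (by decide),
    h.rows_eq_zero h2 3 (by decide), h.rows_eq_zero h2 5 (by decide),
    h.rows_eq_zero h2 6 (by decide)] at this
  simp [e] at this
  linear_combination this

end IsSim

end

/-! ### Points of `Gw` with diagonal second component -/

section

variable {R : Type u} [CommRing R]

theorem coe_scalar {n : ℕ} (t : Rˣ) :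
    ((Matrix.GeneralLinearGroup.scalar (Fin n) t : Matrix.GeneralLinearGroup (Fin n) R) :
      Matrix (Fin n) (Fin n) R) = (t : R) • 1 := by
  rw [Matrix.smul_one_eq_diagonal]
  rfl

theorem d_mul_scal_fst (A : Matrix.GeneralLinearGroup (Fin 2) R) (t : Rˣ) :
    ((d A * scal t).1 : Matrix (Fin 7) (Fin 7) R) = ((t⁻¹ : Rˣ) : R) • ((d₁ A :
      Matrix.GeneralLinearGroup (Fin 7) R) : Matrix (Fin 7) (Fin 7) R) := by
  rw [d, scal, Prod.mk_mul_mk, Units.val_mul, coe_scalar, mul_smul_comm, mul_one]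

theorem d_mul_scal_snd (A : Matrix.GeneralLinearGroup (Fin 2) R) (t : Rˣ) :
    ((d A * scal t).2 : Matrix (Fin 2) (Fin 2) R) =
      !![(t : R) * (Matrix.GeneralLinearGroup.det A : Rˣ), 0;
        0, (t : R) * ((Matrix.GeneralLinearGroup.det A)⁻¹ : Rˣ)] := by
  rw [d, scal, Prod.mk_mul_mk, Units.val_mul, coe_scalar, mul_smul_comm, mul_one]
  ext i j
  fin_cases i <;> fin_cases j <;> simp [diag₂]

/-- For a row i other than 1 and 4, N kills the vector (Mᵢ₁, Mᵢ₄), and N is invertible. -/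
theorem exists_isSim {g : Amb R} (hg : g ∈ Gw R) :
    ∃ c : Rˣ, IsSim (g.1 : Matrix (Fin 7) (Fin 7) R) c := by
  obtain ⟨⟨h1, -⟩, hw⟩ := hg
  obtain ⟨c, hc⟩ := mem_G₁_iff.1 h1
  rw [act_w_eq_iff] at hw
  have key (i : Fin 7) (h1 : i ≠ 1) (h4 : i ≠ 4) :
      (g.2 : Matrix (Fin 2) (Fin 2) R) *ᵥ ![(g.1 : Matrix (Fin 7) (Fin 7) R) i 1,
        (g.1 : Matrix (Fin 7) (Fin 7) R) i 4] = 0 := by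
    funext a
    simpa [Matrix.mulVec, dotProduct, Fin.sum_univ_two, Matrix.one_apply_ne h1,
      Matrix.one_apply_ne h4] using hw a i
  have key' (i : Fin 7) (h1 : i ≠ 1) (h4 : i ≠ 4) : ![(g.1 : Matrix (Fin 7) (Fin 7) R) i 1,
        (g.1 : Matrix (Fin 7) (Fin 7) R) i 4] = 0 := by
    have := congrArg (fun v => ((g.2⁻¹ : Matrix.GeneralLinearGroup (Fin 2) R) :
      Matrix (Fin 2) (Fin 2) R) *ᵥ v) (key i h1 h4)
    rwa [Matrix.mulVec_mulVec, Matrix.mulVec_zero, Units.inv_mul, Matrix.one_mulVec] at this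
  exact ⟨c, hc, fun i h1 h4 => congrFun (key' i h1 h4) 0, fun i h1 h4 => congrFun (key' i h1 h4) 1⟩

theorem Gw_block {g : Amb R} (hg : g ∈ Gw R) :
    (g.2 : Matrix (Fin 2) (Fin 2) R) 0 0 * (g.1 : Matrix (Fin 7) (Fin 7) R) 1 1 +
      (g.2 : Matrix (Fin 2) (Fin 2) R) 0 1 * (g.1 : Matrix (Fin 7) (Fin 7) R) 1 4 = 1 ∧
    (g.2 : Matrix (Fin 2) (Fin 2) R) 0 0 * (g.1 : Matrix (Fin 7) (Fin 7) R) 4 1 +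
      (g.2 : Matrix (Fin 2) (Fin 2) R) 0 1 * (g.1 : Matrix (Fin 7) (Fin 7) R) 4 4 = 0 ∧
    (g.2 : Matrix (Fin 2) (Fin 2) R) 1 0 * (g.1 : Matrix (Fin 7) (Fin 7) R) 1 1 +
      (g.2 : Matrix (Fin 2) (Fin 2) R) 1 1 * (g.1 : Matrix (Fin 7) (Fin 7) R) 1 4 = 0 ∧
    (g.2 : Matrix (Fin 2) (Fin 2) R) 1 0 * (g.1 : Matrix (Fin 7) (Fin 7) R) 4 1 +
      (g.2 : Matrix (Fin 2) (Fin 2) R) 1 1 * (g.1 : Matrix (Fin 7) (Fin 7) R) 4 4 = 1 := by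
  have h := (act_w_eq_iff g).1 hg.2
  refine ⟨(h 0 1).trans ?_, (h 0 4).trans ?_, (h 1 1).trans ?_, (h 1 4).trans ?_⟩ <;> simp

/-- N is the inverse transpose of the block of M on ⟨e₂, e₅⟩, so these products are, up to sign and
a squared unit, M₄₁M₄₄ and M₁₁M₁₄. -/
theorem Gw_snd_mul (h2 : IsUnit (2 : R)) {g : Amb R} (hg : g ∈ Gw R) :
    (g.2 : Matrix (Fin 2) (Fin 2) R) 0 0 * (g.2 : Matrix (Fin 2) (Fin 2) R) 0 1 = 0 ∧
    (g.2 : Matrix (Fin 2) (Fin 2) R) 1 0 * (g.2 : Matrix (Fin 2) (Fin 2) R) 1 1 = 0 := by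
  obtain ⟨c, hc⟩ := exists_isSim hg
  obtain ⟨b1, b2, b3, b4⟩ := Gw_block hg
  have hd := hc.isUnit_det h2
  have r1 := hc.row1_mul h2
  have r4 := hc.row4_mul h2
  generalize (g.2 : Matrix (Fin 2) (Fin 2) R) = N at *
  generalize (g.1 : Matrix (Fin 7) (Fin 7) R) = M at *
  have e00 : (M 1 1 * M 4 4 - M 1 4 * M 4 1) * N 0 0 = M 4 4 := by
    linear_combination M 4 4 * b1 - M 1 4 * b2
  have e01 : (M 1 1 * M 4 4 - M 1 4 * M 4 1) * N 0 1 = - M 4 1 := by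
    linear_combination - M 4 1 * b1 + M 1 1 * b2
  have e10 : (M 1 1 * M 4 4 - M 1 4 * M 4 1) * N 1 0 = - M 1 4 := by
    linear_combination M 4 4 * b3 - M 1 4 * b4
  have e11 : (M 1 1 * M 4 4 - M 1 4 * M 4 1) * N 1 1 = M 1 1 := by
    linear_combination - M 4 1 * b3 + M 1 1 * b4
  constructor
  · refine (hd.mul hd).mul_left_cancel ?_
    rw [mul_mul_mul_comm, e00, e01]
    linear_combination -r4
  · refine (hd.mul hd).mul_left_cancel ?_
    rw [mul_mul_mul_comm, e10, e11]
    linear_combination -r1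

theorem eq_zero_of_minor2 {x y : R} {a b c d : R} (hd : IsUnit (a * d - b * c))
    (h1 : a * y - b * x = 0) (h2 : c * y - d * x = 0) : x = 0 ∧ y = 0 :=
  ⟨hd.mul_left_cancel (by linear_combination c * h1 - a * h2),
    hd.mul_left_cancel (by linear_combination d * h1 - b * h2)⟩

/-- With a = M₀₀, the scalar is t = a⁻¹, and A is a⁻¹ times the block of M in rows and columns 2, 3.
-/
theorem exists_eq_d_mul_scal (h2 : IsUnit (2 : R)) {g : Amb R} (hg : g ∈ Gw R)
    (h01 : (g.2 : Matrix (Fin 2) (Fin 2) R) 0 1 = 0)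
    (h10 : (g.2 : Matrix (Fin 2) (Fin 2) R) 1 0 = 0) :
    ∃ (A : Matrix.GeneralLinearGroup (Fin 2) R) (t : Rˣ), g = d A * scal t := by
  obtain ⟨c, hc⟩ := exists_isSim hg
  obtain ⟨b1, b2, b3, b4⟩ := Gw_block hg
  obtain ⟨N, hN⟩ : ∃ N, (g.2 : Matrix (Fin 2) (Fin 2) R) = N := ⟨_, rfl⟩
  obtain ⟨M, hM⟩ : ∃ M, (g.1 : Matrix (Fin 7) (Fin 7) R) = M := ⟨_, rfl⟩
  rw [hN] at h01 h10 b1 b2 b3 b4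
  rw [hM] at b1 b2 b3 b4 hc
  rw [h01, zero_mul, add_zero] at b1 b2
  rw [h10, zero_mul, zero_add] at b3 b4
  have hp : IsUnit (M 1 1) := .of_mul_eq_one_right _ b1
  have hr : IsUnit (M 4 4) := .of_mul_eq_one_right _ b4
  have hs : M 4 1 = 0 := (IsUnit.of_mul_eq_one _ b1).mul_right_eq_zero.1 b2
  have hq : M 1 4 = 0 := (IsUnit.of_mul_eq_one _ b4).mul_right_eq_zero.1 b3
  obtain ⟨a, ha⟩ := hc.isUnit_zero_zero h2
  have hpr := hc.permanent_eq h2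
  have hdet := hc.det_eq h2
  rw [hq, zero_mul, add_zero, ← ha] at hpr
  -- The multiplier is c = a³.
  rw [hq, zero_mul, sub_zero, hpr, ← ha] at hdet
  have s0 := hc.triForm_row0
  have s1 := hc.triForm_row1
  have s4 := hc.triForm_row4
  simp only [hc.one_zero h2, hc.four_zero h2, hq, hs, zero_mul, zero_add, add_zero, ← hdet, ← ha]
    at s0 s1 s4
  have hau : IsUnit (a : R) := a.isUnit
  have w (i j : Fin 7) (hi : i ≠ 0 ∧ i ≠ 1 ∧ i ≠ 4) (hj : j ≠ 0 ∧ j ≠ 1 ∧ j ≠ 4) : symp (M i) (M j) = a * a * triForm (e R 0) (e R i) (e R j) :=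
    hau.mul_left_cancel (by linear_combination s0 i j hi hj)
  have z1 (i j : Fin 7) (hi : i ≠ 0 ∧ i ≠ 1 ∧ i ≠ 4) (hj : j ≠ 0 ∧ j ≠ 1 ∧ j ≠ 4)
      (h0 : triForm (e R 1) (e R i) (e R j) = 0) :
      minor2 (M i) (M j) 2 3 = 0 := by
    rw [← hp.mul_right_eq_zero, s1 i j hi hj, h0, mul_zero]
  have z4 (i j : Fin 7) (hi : i ≠ 0 ∧ i ≠ 1 ∧ i ≠ 4) (hj : j ≠ 0 ∧ j ≠ 1 ∧ j ≠ 4)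
      (h0 : triForm (e R 4) (e R i) (e R j) = 0) :
      minor2 (M i) (M j) 5 6 = 0 := by
    rw [← hr.mul_right_eq_zero, s4 i j hi hj, h0, mul_zero]
  have v1 : M 1 1 * minor2 (M 2) (M 3) 2 3 = a * (a * a) := by
    rw [s1 2 3 (by decide) (by decide)]; simp [triForm, minor3, e]
  have v4 : M 4 4 * minor2 (M 5) (M 6) 5 6 = a * (a * a) := by
    rw [s4 5 6 (by decide) (by decide)]; simp [triForm, minor3, e]
  have u1 : IsUnit (minor2 (M 2) (M 3) 2 3) :=
    isUnit_of_mul_isUnit_right (x := M 1 1) (v1 ▸ hau.mul (hau.mul hau))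
  have u4 : IsUnit (minor2 (M 5) (M 6) 5 6) :=
    isUnit_of_mul_isUnit_right (x := M 4 4) (v4 ▸ hau.mul (hau.mul hau))
  -- In columns 2, 3 the rows 2, 3 form an invertible block, and row 5 has zero minors with both.
  -- The same argument for the other rows makes H block diagonal.
  have o5 : M 5 2 = 0 ∧ M 5 3 = 0 := eq_zero_of_minor2 u1
    (z1 2 5 (by decide) (by decide) (by simp [triForm, minor3, e]))
    (z1 3 5 (by decide) (by decide) (by simp [triForm, minor3, e]))
  have o6 : M 6 2 = 0 ∧ M 6 3 = 0 := eq_zero_of_minor2 u1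
    (z1 2 6 (by decide) (by decide) (by simp [triForm, minor3, e]))
    (z1 3 6 (by decide) (by decide) (by simp [triForm, minor3, e]))
  have o2 : M 2 5 = 0 ∧ M 2 6 = 0 := eq_zero_of_minor2 u4
    (z4 5 2 (by decide) (by decide) (by simp [triForm, minor3, e]))
    (z4 6 2 (by decide) (by decide) (by simp [triForm, minor3, e]))
  have o3 : M 3 5 = 0 ∧ M 3 6 = 0 := eq_zero_of_minor2 u4
    (z4 5 3 (by decide) (by decide) (by simp [triForm, minor3, e]))
    (z4 6 3 (by decide) (by decide) (by simp [triForm, minor3, e]))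
  have w25 := w 2 5 (by decide) (by decide)
  have w26 := w 2 6 (by decide) (by decide)
  have w35 := w 3 5 (by decide) (by decide)
  have w36 := w 3 6 (by decide) (by decide)
  simp only [symp, o5, o6, o2, o3] at w25 w26 w35 w36
  simp [triForm, minor3, e] at w25 w26 w35 w36
  obtain ⟨b, hab⟩ : ∃ b : R, a * b = 1 := ⟨_, a.mul_inv⟩
  -- The symplectic relations divided by a²: the scaled lower block is the inverse transpose of the
  -- upper one.
  have hAB : b • !![M 2 2, M 2 3; M 3 2, M 3 3] * b • !![M 5 5, M 6 5; M 5 6, M 6 6] = 1 := by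
    ext i j
    fin_cases i <;> fin_cases j <;> simp [Matrix.mul_apply, Fin.sum_univ_two]
    · linear_combination b * b * w25 + (a * b + 1) * hab
    · linear_combination b * b * w26
    · linear_combination b * b * w35
    · linear_combination b * b * w36 + (a * b + 1) * hab
  let A : Matrix.GeneralLinearGroup (Fin 2) R := ⟨_, _, hAB, mul_eq_one_comm.1 hAB⟩
  -- `v1` gives M₁₁ det A = a, and M₁₁M₄₄ = a² turns this into det A = a⁻¹M₄₄.
  have hdA : ((Matrix.GeneralLinearGroup.det A : Rˣ) : R) = b * M 4 4 := by
    have : ((Matrix.GeneralLinearGroup.det A : Rˣ) : R) = b * b * minor2 (M 2) (M 3) 2 3 := by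
      rw [Matrix.GeneralLinearGroup.val_det_apply]
      change (b • !![M 2 2, M 2 3; M 3 2, M 3 3]).det = _
      rw [Matrix.det_fin_two]
      simp [minor2]
      ring
    rw [this]
    refine hp.mul_left_cancel ?_
    linear_combination b * b * v1 - b * hpr + a * a * b * hab
  have hdA' : (((Matrix.GeneralLinearGroup.det A)⁻¹ : Rˣ) : R) = b * M 1 1 := by
    refine Units.inv_eq_of_mul_eq_one_right ?_
    rw [hdA]
    linear_combination b * b * hpr + (a * b + 1) * hab
  have hb : ((a⁻¹ : Rˣ) : R) = b := Units.inv_eq_of_mul_eq_one_right hab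
  refine ⟨A, a⁻¹, Prod.ext (Units.ext ?_) (Units.ext ?_)⟩
  · rw [d_mul_scal_fst, inv_inv, hM]
    change M = (a : R) • blockMatrix ((Matrix.GeneralLinearGroup.det A : Rˣ) : R)
      (((Matrix.GeneralLinearGroup.det A)⁻¹ : Rˣ) : R) (b • !![M 2 2, M 2 3; M 3 2, M 3 3])
      (b • !![M 5 5, M 6 5; M 5 6, M 6 6])
    rw [hdA, hdA']
    have c (x : R) : a * (b * x) = x := by linear_combination x * hab
    have c0 := hc.col0
    have c1 := hc.col1
    have c4 := hc.col4
    have rz := hc.rows_eq_zero h2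
    ext i j
    fin_cases i <;> fin_cases j <;>
      simp [blockMatrix, c, o2, o3, o5, o6, ← ha, hq, hs, hc.one_zero h2, hc.four_zero h2, c0, c1,
        c4, rz]
  · rw [d_mul_scal_snd, hN, hdA, hdA', hb]
    ext i j
    fin_cases i <;> fin_cases j <;> simp [h01, h10]
    · refine hp.mul_left_cancel ?_
      linear_combination b1 - b * b * hpr - (a * b + 1) * hab
    · refine hr.mul_left_cancel ?_
      linear_combination b4 - b * b * hpr - (a * b + 1) * hab

end

/-! ### The elements d(A), (t⁻¹I₇, tI₂) and `τ` lie in `Gw` -/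

section

variable {R : Type u} [CommRing R]

/-- The entrywise hypotheses spell out B = A⁻¹ through the adjugate, leaving polynomial identities
modulo δδ' = 1. -/
theorem triForm_blockMatrix {δ δ' : R} {A B : Matrix (Fin 2) (Fin 2) R}
    (hδ : δ * δ' = 1) (hA : A 0 0 * A 1 1 - A 0 1 * A 1 0 = δ)
    (h00 : B 0 0 = δ' * A 1 1) (h01 : B 0 1 = -(δ' * A 0 1)) (h10 : B 1 0 = -(δ' * A 1 0))
    (h11 : B 1 1 = δ' * A 0 0) (i j l : Fin 7) (hij : i < j) (hjl : j < l) :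
    triForm (blockMatrix δ δ' A B i) (blockMatrix δ δ' A B j) (blockMatrix δ δ' A B l) =
      triForm (e R i) (e R j) (e R l) := by
  fin_cases i <;> fin_cases j <;> first | exact absurd hij (by decide) | (
    fin_cases l <;> first | exact absurd hjl (by decide) | (
    simp [triForm, minor3, e, blockMatrix, h00, h01, h10, h11]
    try grind))

/-- The matrix `ε + (1 - ε) τ₁`. -/
def mixMatrix (ε : R) : Matrix (Fin 7) (Fin 7) R :=
  !![1, 0, 0, 0, 0, 0, 0;
     0, ε, 0, 0, 1 - ε, 0, 0;
     0, 0, ε, 0, 0, 1 - ε, 0;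
     0, 0, 0, ε, 0, 0, ε - 1;
     0, 1 - ε, 0, 0, ε, 0, 0;
     0, 0, 1 - ε, 0, 0, ε, 0;
     0, 0, 0, ε - 1, 0, 0, ε]

/-- `τ₁Matrix` multiplies `w̄` by -1; the multiplier 2ε - 1 is 1 at ε = 1 and -1 at ε = 0. -/
theorem triForm_mixMatrix {ε : R} (h : ε * ε = ε) (i j l : Fin 7) (hij : i < j) (hjl : j < l) :
    triForm (mixMatrix ε i) (mixMatrix ε j) (mixMatrix ε l) =
      (2 * ε - 1) * triForm (e R i) (e R j) (e R l) := by
  fin_cases i <;> fin_cases j <;> first | exact absurd hij (by decide) | (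
    fin_cases l <;> first | exact absurd hjl (by decide) | (
    simp [triForm, minor3, e, mixMatrix]
    try grind))

end

section

variable {R : Type u} [CommRing R]

/-- Since τ₁² = 1, the coefficients of 1 and τ₁ in the product again sum to 1. On idempotents this
law is addition in ℤ/2, with neutral element 1. -/
theorem mixMatrix_mul (ε η : R) :
    mixMatrix ε * mixMatrix η = mixMatrix (ε * η + (1 - ε) * (1 - η)) := by
  ext i j
  fin_cases i <;> fin_cases j <;>
    simp [mixMatrix, Matrix.mul_apply, Fin.sum_univ_succ] <;> ring

theorem mixMatrix_one : mixMatrix (1 : R) = 1 := by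
  ext i j
  fin_cases i <;> fin_cases j <;> simp [mixMatrix]

theorem mixMatrix_zero : mixMatrix (0 : R) = τ₁Matrix R := by
  ext i j
  fin_cases i <;> fin_cases j <;> simp [mixMatrix, τ₁Matrix]

theorem mix_self {ε : R} (h : IsIdempotentElem ε) : ε * ε + (1 - ε) * (1 - ε) = 1 := by
  linear_combination 2 * h.eq

theorem mixMatrix₂_mul (ε η : R) :
    !![ε, 1 - ε; 1 - ε, ε] * !![η, 1 - η; 1 - η, η] =
      !![ε * η + (1 - ε) * (1 - η), 1 - (ε * η + (1 - ε) * (1 - η));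
        1 - (ε * η + (1 - ε) * (1 - η)), ε * η + (1 - ε) * (1 - η)] := by
  ext i j
  fin_cases i <;> fin_cases j <;> simp <;> ring

theorem mixMatrix₂_sq {ε : R} (h : IsIdempotentElem ε) :
    !![ε, 1 - ε; 1 - ε, ε] * !![ε, 1 - ε; 1 - ε, ε] = 1 := by
  rw [mixMatrix₂_mul, mix_self h, sub_self, Matrix.one_fin_two]

/-- The element of `G_w` which is `1` where `ε = 1` and `τ` where `ε = 0`. -/
def mix (ε : R) (h : IsIdempotentElem ε) : Amb R :=
  (⟨mixMatrix ε, mixMatrix ε, by rw [mixMatrix_mul, mix_self h, mixMatrix_one],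
      by rw [mixMatrix_mul, mix_self h, mixMatrix_one]⟩,
    ⟨!![ε, 1 - ε; 1 - ε, ε], !![ε, 1 - ε; 1 - ε, ε],
      mixMatrix₂_sq h, mixMatrix₂_sq h⟩)

theorem mix_mul {ε η ζ : R} (h : IsIdempotentElem ε) (h' : IsIdempotentElem η)
    (h'' : IsIdempotentElem ζ) (hζ : ζ = ε * η + (1 - ε) * (1 - η)) :
    mix ε h * mix η h' = mix ζ h'' := by
  subst hζ
  exact Prod.ext (Units.ext (mixMatrix_mul ε η)) (Units.ext (mixMatrix₂_mul ε η))

theorem mix_zero : mix (0 : R) .zero = τ R :=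
  Prod.ext (Units.ext mixMatrix_zero) (Units.ext (by
    change !![_, _; _, _] = !![_, _; _, _]
    simp))

theorem mix_mem_Gw {ε : R} (h : IsIdempotentElem ε) : mix ε h ∈ Gw R := by
  -- The multiplier 2ε - 1 is its own inverse, as ε is idempotent.
  refine ⟨⟨mem_G₁_iff.2 ⟨⟨2 * ε - 1, 2 * ε - 1, ?_, ?_⟩, ?_⟩, trivial⟩, ?_⟩
  · linear_combination 4 * h.eq
  · linear_combination 4 * h.eq
  · exact triForm_mixMatrix h.eq
  · rw [act_w_eq_iff]
    intro a i
    have := h.eq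
    fin_cases a <;> fin_cases i <;> simp [mix, mixMatrix, Matrix.one_apply] <;> grind

theorem τ_mem_Gw : τ R ∈ Gw R := mix_zero (R := R) ▸ mix_mem_Gw .zero

theorem d_mem_Gw (A : Matrix.GeneralLinearGroup (Fin 2) R) : d A ∈ Gw R := by
  have hδ := (Matrix.GeneralLinearGroup.det A).mul_inv
  have hA : ((Matrix.GeneralLinearGroup.det A : Rˣ) : R) = (A : Matrix (Fin 2) (Fin 2) R).det :=
    rfl
  have hi : ((A⁻¹ : Matrix.GeneralLinearGroup (Fin 2) R) : Matrix (Fin 2) (Fin 2) R) =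
      (((Matrix.GeneralLinearGroup.det A)⁻¹ : Rˣ) : R) •
        (A : Matrix (Fin 2) (Fin 2) R).adjugate := by
    refine (Units.mul_right_inj A).1 ?_
    rw [Units.mul_inv, mul_smul_comm, Matrix.mul_adjugate, smul_smul, ← hA, Units.inv_mul,
      one_smul]
  refine ⟨⟨mem_G₁_iff.2 ⟨1, fun i j l hij hjl => ?_⟩, trivial⟩, ?_⟩
  · rw [Units.val_one, one_mul]
    refine triForm_blockMatrix hδ ?_ ?_ ?_ ?_ ?_ i j l hij hjl
    · rw [hA, Matrix.det_fin_two]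
    all_goals
      rw [hi, Matrix.adjugate_fin_two]
      generalize (Matrix.GeneralLinearGroup.det A)⁻¹ = u
      simp
  · rw [act_w_eq_iff]
    intro a i
    simp only [d, d₁, diag₂]
    generalize Matrix.GeneralLinearGroup.det A = u
    fin_cases a <;> fin_cases i <;> simp [blockMatrix, Matrix.one_apply]

theorem scal_mem_Ttilde (t : Rˣ) : scal t ∈ Ttilde R := by
  refine ⟨⟨⟨t⁻¹ ^ 3, ?_⟩, trivial⟩, fun M => LinearMap.ext fun v => ?_⟩
  · have h : (scal t).1 = Matrix.GeneralLinearGroup.scalar (Fin 7) t⁻¹ := rfl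
    have he (i j l : Fin 7) : wedgeAct (scal t).1 (e3 R i j l) =
        ((t⁻¹ ^ 3 : Rˣ) : R) • e3 R i j l := by
      rw [wedgeAct, e3, exteriorPower.map_apply_ιMulti, h, coe_scalar]
      have := (exteriorPower.ιMulti R 3).map_smul_univ (fun _ => ((t⁻¹ : Rˣ) : R))
        ![e R i, e R j, e R l]
      rw [Finset.prod_const, Finset.card_univ, Fintype.card_fin] at this
      rw [Units.val_pow_eq_pow_val, ← this]
      congr 1
      funext a
      fin_cases a <;> simp
    simp only [wBar, map_add, he, smul_add]
  · rw [act_apply]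
    change (((Matrix.GeneralLinearGroup.scalar (Fin 7) t⁻¹ : Matrix.GeneralLinearGroup (Fin 7) R) :
      Matrix (Fin 7) (Fin 7) R)) *ᵥ M (v ᵥ* (((Matrix.GeneralLinearGroup.scalar (Fin 2) t :
        Matrix.GeneralLinearGroup (Fin 2) R)) : Matrix (Fin 2) (Fin 2) R)) = M v
    rw [coe_scalar, coe_scalar, Matrix.vecMul_smul, Matrix.vecMul_one, map_smul,
      Matrix.smul_mulVec, Matrix.one_mulVec, smul_smul, Units.inv_mul, one_smul]

theorem scal_mem_Gw (t : Rˣ) : scal t ∈ Gw R :=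
  ⟨(scal_mem_Ttilde t).1, (scal_mem_Ttilde t).2 _⟩

theorem scal_mul (s t : Rˣ) : scal (R := R) (s * t) = scal s * scal t :=
  Prod.ext (by simp [scal, mul_comm]) (by simp [scal])

theorem scal_comm (t : Rˣ) (g : Amb R) : scal t * g = g * scal t :=
  Prod.ext (Units.ext (by
      change _ * (g.1 : Matrix (Fin 7) (Fin 7) R) = (g.1 : Matrix (Fin 7) (Fin 7) R) * _
      simp only [scal, coe_scalar, smul_mul_assoc, mul_smul_comm, one_mul, mul_one]))
    (Units.ext (by
      change _ * (g.2 : Matrix (Fin 2) (Fin 2) R) = (g.2 : Matrix (Fin 2) (Fin 2) R) * _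
      simp only [scal, coe_scalar, smul_mul_assoc, mul_smul_comm, one_mul, mul_one]))

theorem blockMatrix_mul_blockMatrix (δ δ' ε ε' : R) (A B C D : Matrix (Fin 2) (Fin 2) R) :
    blockMatrix δ δ' A B * blockMatrix ε ε' C D =
      blockMatrix (δ * ε) (δ' * ε') (A * C) (D * B) := by
  ext i j
  fin_cases i <;> fin_cases j <;>
    simp [blockMatrix, Matrix.mul_apply, Fin.sum_univ_succ] <;> ring

theorem d_mul (A B : Matrix.GeneralLinearGroup (Fin 2) R) : d (A * B) = d A * d B := by
  refine Prod.ext (Units.ext ?_) (Units.ext ?_)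
  · change blockMatrix _ _ _ _ = blockMatrix _ _ _ _ * blockMatrix _ _ _ _
    rw [blockMatrix_mul_blockMatrix, map_mul, mul_inv, mul_inv_rev]
    rfl
  · change !![_, _; _, _] = !![_, _; _, _] * !![_, _; _, _]
    rw [Matrix.mul_fin_two]
    simp [mul_comm]

/-- The homomorphism `(A, t) ↦ d(A) (t⁻¹ I₇, t I₂)`. -/
def param (R : Type u) [CommRing R] : Matrix.GeneralLinearGroup (Fin 2) R × Rˣ →* Amb R where
  toFun x := d x.1 * scal x.2
  map_one' := by
    have h1 : d (1 : Matrix.GeneralLinearGroup (Fin 2) R) = 1 := by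
      simpa using d_mul (1 : Matrix.GeneralLinearGroup (Fin 2) R) 1
    have h2 : scal (1 : Rˣ) = 1 := by simpa using scal_mul (1 : Rˣ) 1
    simp [h1, h2]
  map_mul' x y := by
    rw [Prod.fst_mul, Prod.snd_mul, d_mul, scal_mul, mul_assoc, mul_assoc, ← mul_assoc (d y.1),
      ← scal_comm x.2, mul_assoc]

theorem param_apply (A : Matrix.GeneralLinearGroup (Fin 2) R) (t : Rˣ) :
    param R (A, t) = d A * scal t := rfl

theorem param_mem_Gw (x : Matrix.GeneralLinearGroup (Fin 2) R × Rˣ) : param R x ∈ Gw R :=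
  mul_mem (d_mem_Gw _) (scal_mem_Gw _)

theorem param_injective : Function.Injective (param R) := by
  rw [injective_iff_map_eq_one]
  rintro ⟨A, t⟩ h
  have h1 := congrArg (fun g : Amb R => (g.1 : Matrix (Fin 7) (Fin 7) R)) h
  rw [param_apply] at h1
  simp only [d_mul_scal_fst] at h1
  -- This entry is t⁻¹; once t = 1, the block in rows and columns 2, 3 is A.
  have ht := congrFun (congrFun h1 0) 0
  simp [d₁, blockMatrix] at ht
  subst ht
  have e22 := congrFun (congrFun h1 2) 2
  have e23 := congrFun (congrFun h1 2) 3
  have e32 := congrFun (congrFun h1 3) 2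
  have e33 := congrFun (congrFun h1 3) 3
  simp [d₁, blockMatrix] at e22 e23 e32 e33
  refine Prod.ext (Units.ext ?_) rfl
  ext i j
  fin_cases i <;> fin_cases j <;> simp [*]

end

/-! ### The idempotent separating `Gw0` from its other coset -/

section

variable {R S : Type u} [CommRing R] [CommRing S]

/-- The function on `G_w` with value `1` on `G_w⁰` and `0` on `τ G_w⁰`. -/
def idem (g : Amb R) : R :=
  (g.2 : Matrix (Fin 2) (Fin 2) R) 0 0 * (g.2 : Matrix (Fin 2) (Fin 2) R) 1 1 *
    ((Matrix.GeneralLinearGroup.det g.2)⁻¹ : Rˣ)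

theorem det_snd_mul_inv (g : Amb R) :
    ((g.2 : Matrix (Fin 2) (Fin 2) R) 0 0 * (g.2 : Matrix (Fin 2) (Fin 2) R) 1 1 -
      (g.2 : Matrix (Fin 2) (Fin 2) R) 0 1 * (g.2 : Matrix (Fin 2) (Fin 2) R) 1 0) *
        ((Matrix.GeneralLinearGroup.det g.2)⁻¹ : Rˣ) = 1 := by
  rw [← Matrix.det_fin_two, ← Matrix.GeneralLinearGroup.val_det_apply, Units.mul_inv]

/-- Here 1 - idem g = -N₀₁N₁₀/det N, and its product with idem g contains the factor N₀₀N₀₁ = 0. -/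
theorem idem_isIdempotentElem (h2 : IsUnit (2 : R)) {g : Amb R} (hg : g ∈ Gw R) :
    IsIdempotentElem (idem g) := by
  have hd := det_snd_mul_inv g
  have h0 := (Gw_snd_mul h2 hg).1
  rw [IsIdempotentElem, idem]
  generalize (((Matrix.GeneralLinearGroup.det g.2)⁻¹ : Rˣ) : R) = v at *
  generalize (g.2 : Matrix (Fin 2) (Fin 2) R) = N at *
  linear_combination N 0 0 * N 1 1 * v * hd + N 1 0 * N 1 1 * v * v * h0

/-- With L the second component of h, the cross terms in the product of diagonal entries of NL
contain L₀₀L₀₁ or L₁₀L₁₁, both zero. -/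
theorem idem_mul (h2 : IsUnit (2 : R)) (g : Amb R) {h : Amb R} (hh : h ∈ Gw R) :
    idem (g * h) = idem g * idem h + (1 - idem g) * (1 - idem h) := by
  have hdg := det_snd_mul_inv g
  have hdh := det_snd_mul_inv h
  obtain ⟨h0, h1⟩ := Gw_snd_mul h2 hh
  have e : (((Matrix.GeneralLinearGroup.det (g * h).2)⁻¹ : Rˣ) : R) =
      ((Matrix.GeneralLinearGroup.det g.2)⁻¹ : Rˣ) *
        ((Matrix.GeneralLinearGroup.det h.2)⁻¹ : Rˣ) := by
    rw [Prod.snd_mul, map_mul, mul_inv, Units.val_mul]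
  simp only [idem, e]
  rw [Prod.snd_mul, Units.val_mul, Matrix.mul_apply, Matrix.mul_apply, Fin.sum_univ_two,
    Fin.sum_univ_two]
  generalize (((Matrix.GeneralLinearGroup.det g.2)⁻¹ : Rˣ) : R) = v at *
  generalize (((Matrix.GeneralLinearGroup.det h.2)⁻¹ : Rˣ) : R) = u at *
  generalize (g.2 : Matrix (Fin 2) (Fin 2) R) = N at *
  generalize (h.2 : Matrix (Fin 2) (Fin 2) R) = L at *
  linear_combination v * u * N 0 0 * N 1 0 * h0 + v * u * N 0 1 * N 1 1 * h1 +
    (1 - N 0 0 * N 1 1 * v) * hdh - (L 0 1 * L 1 0 * u) * hdg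

theorem idem_mix {ε : R} (h : IsIdempotentElem ε) : idem (mix ε h) = ε := by
  have hd := det_snd_mul_inv (mix ε h)
  rw [idem]
  simp only [show ((mix ε h).2 : Matrix (Fin 2) (Fin 2) R) = !![ε, 1 - ε; 1 - ε, ε] from rfl]
    at hd ⊢
  generalize (((Matrix.GeneralLinearGroup.det (mix ε h).2)⁻¹ : Rˣ) : R) = v at *
  simp at hd ⊢
  linear_combination ε * hd - v * h.eq

theorem idem_τ : idem (τ R) = 0 := mix_zero (R := R) ▸ idem_mix .zero

theorem idem_param (x : Matrix.GeneralLinearGroup (Fin 2) R × Rˣ) : idem (param R x) = 1 := by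
  have hd := det_snd_mul_inv (param R x)
  rw [idem]
  have : ((param R x).2 : Matrix (Fin 2) (Fin 2) R) 0 1 = 0 := by
    rw [param_apply, d_mul_scal_snd]; rfl
  rwa [this, zero_mul, sub_zero] at hd

/-- If idem g = 1, then N₀₀ and N₁₁ are units, so the vanishing products force N to be diagonal. -/
theorem mem_range_param_iff (h2 : IsUnit (2 : R)) {g : Amb R} (hg : g ∈ Gw R) :
    g ∈ (param R).range ↔ idem g = 1 := by
  refine ⟨fun ⟨x, hx⟩ => hx ▸ idem_param x, fun h => ?_⟩
  have hd := det_snd_mul_inv g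
  obtain ⟨h0, h1⟩ := Gw_snd_mul h2 hg
  rw [idem] at h
  have u : IsUnit ((g.2 : Matrix (Fin 2) (Fin 2) R) 0 0 * (g.2 : Matrix (Fin 2) (Fin 2) R) 1 1) :=
    .of_mul_eq_one _ h
  obtain ⟨A, t, hA⟩ := exists_eq_d_mul_scal h2 hg
    ((isUnit_of_mul_isUnit_left u).mul_right_eq_zero.1 h0)
    ((isUnit_of_mul_isUnit_right u).mul_left_eq_zero.1 h1)
  exact ⟨(A, t), hA.symm⟩

theorem mem_Ttilde_iff {g : Amb R} : g ∈ Ttilde R ↔ ∃ t, scal t = g := by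
  refine ⟨fun h => ?_, fun ⟨t, ht⟩ => ht ▸ scal_mem_Ttilde t⟩
  have key (a b : Fin 2) (i j : Fin 7) : (g.2 : Matrix (Fin 2) (Fin 2) R) a b *
      (g.1 : Matrix (Fin 7) (Fin 7) R) i j = if a = b ∧ i = j then 1 else 0 := by
    -- The test elements are the rank one maps v ↦ v_b e_j.
    have := congrFun (LinearMap.congr_fun (h.2 ((LinearMap.proj b : (Fin 2 → R) →ₗ[R] R).smulRight
      (Pi.single j 1 : Fin 7 → R))) (Pi.single a 1)) i
    rw [act_apply] at this
    simp [Matrix.mulVec_smul, Pi.single_apply] at this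
    rw [this]
    by_cases hab : a = b <;> by_cases hij : i = j <;> simp [hab, hij, eq_comm]
  have h00 (i) : (g.2 : Matrix (Fin 2) (Fin 2) R) 0 0 * (g.1 : Matrix (Fin 7) (Fin 7) R) i i = 1 :=
    by simp [key]
  obtain ⟨t, ht⟩ : IsUnit ((g.2 : Matrix (Fin 2) (Fin 2) R) 0 0) := .of_mul_eq_one _ (h00 0)
  have hii (i) : (g.1 : Matrix (Fin 7) (Fin 7) R) i i = (t⁻¹ : Rˣ) := by
    rw [← ht] at h00
    exact (Units.inv_eq_of_mul_eq_one_right (h00 i)).symm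
  refine ⟨t, Prod.ext (Units.ext ?_) (Units.ext ?_)⟩
  · ext i j
    rw [scal, coe_scalar]
    by_cases hij : i = j
    · subst hij
      simp [hii]
    · have := key 0 0 i j
      rw [← ht, if_neg fun h => hij h.2] at this
      simp [(Units.mul_right_eq_zero t).1 this, hij]
  · ext a b
    rw [scal, coe_scalar]
    have := key a b 0 0
    rw [hii, Units.mul_inv_eq_iff_eq_mul] at this
    rw [this]
    by_cases hab : a = b <;> simp [hab]

theorem Amb.map_fst (φ : R →+* S) (g : Amb R) (i j : Fin 7) :
    ((Amb.map φ g).1 : Matrix (Fin 7) (Fin 7) S) i j =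
      φ ((g.1 : Matrix (Fin 7) (Fin 7) R) i j) := rfl

theorem Amb.map_snd (φ : R →+* S) (g : Amb R) (i j : Fin 2) :
    ((Amb.map φ g).2 : Matrix (Fin 2) (Fin 2) S) i j =
      φ ((g.2 : Matrix (Fin 2) (Fin 2) R) i j) := rfl

theorem map_triForm (φ : R →+* S) (x y z : Fin 7 → R) :
    φ (triForm x y z) = triForm (φ ∘ x) (φ ∘ y) (φ ∘ z) := by
  simp [triForm, minor3]

theorem map_mem_Gw (φ : R →+* S) {g : Amb R} (hg : g ∈ Gw R) : Amb.map φ g ∈ Gw S := by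
  obtain ⟨⟨h1, -⟩, hw⟩ := hg
  obtain ⟨c, hc⟩ := mem_G₁_iff.1 h1
  have he (i : Fin 7) : φ ∘ e R i = e S i := by
    funext j
    simp [e, Pi.single_apply, apply_ite φ]
  refine ⟨⟨mem_G₁_iff.2 ⟨Units.map φ c, fun i j l hij hjl => ?_⟩, trivial⟩, ?_⟩
  · have := congrArg φ (hc i j l hij hjl)
    rw [map_mul, map_triForm, map_triForm, he, he, he] at this
    exact this
  · rw [act_w_eq_iff] at hw ⊢
    intro a i
    have := congrArg φ (hw a i)
    simpa [Amb.map_fst, Amb.map_snd, Matrix.one_apply, apply_ite φ] using this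

theorem idem_map (φ : R →+* S) (g : Amb R) : idem (Amb.map φ g) = φ (idem g) := by
  have h : Matrix.GeneralLinearGroup.det (Amb.map φ g).2 =
      Units.map φ (Matrix.GeneralLinearGroup.det g.2) := by
    ext
    exact (φ.map_det _).symm
  rw [idem, idem, h, ← map_inv, Amb.map_snd, Amb.map_snd, map_mul, map_mul]
  rfl

theorem map_mix (φ : R →+* S) {ε : R} (h : IsIdempotentElem ε) {η : S} (h' : IsIdempotentElem η)
    (hη : φ ε = η) : Amb.map φ (mix ε h) = mix η h' := by
  subst hη
  refine Prod.ext (Units.ext ?_) (Units.ext ?_)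
  · ext i j
    rw [Amb.map_fst]
    fin_cases i <;> fin_cases j <;> simp [mix, mixMatrix]
  · ext i j
    rw [Amb.map_snd]
    fin_cases i <;> fin_cases j <;> simp [mix]

end

/-! ### The Zariski topology and the identity component over a field -/

section

theorem zariski_basis (K : Type u) [Field K] :
    @TopologicalSpace.IsTopologicalBasis _ (zariski K)
      (Set.range fun p : MvPolynomial (Fin 7 × Fin 7 ⊕ Fin 2 × Fin 2) K =>
        {g : Amb K | MvPolynomial.eval (coords g) p ≠ 0}) := by
  let := zariski K
  refine ⟨?_, ?_, rfl⟩
  · rintro _ ⟨p, rfl⟩ _ ⟨q, rfl⟩ g ⟨hp, hq⟩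
    refine ⟨_, ⟨p * q, rfl⟩, ?_, fun h hh => ?_⟩
    · change MvPolynomial.eval (coords g) (p * q) ≠ 0
      rw [map_mul]
      exact mul_ne_zero hp hq
    · change MvPolynomial.eval (coords h) (p * q) ≠ 0 at hh
      rw [map_mul] at hh
      exact ⟨left_ne_zero_of_mul hh, right_ne_zero_of_mul hh⟩
  · exact Set.sUnion_eq_univ_iff.2 fun g => ⟨_, ⟨1, rfl⟩, by simp⟩

section Regular

variable {K : Type u} [Field K]

/-- The coordinates of a point of `GL(2) × GL(1)`. -/
def entries (x : Matrix.GeneralLinearGroup (Fin 2) K × Kˣ) : Option (Fin 2 × Fin 2) → K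
  | none => x.2
  | some p => (x.1 : Matrix (Fin 2) (Fin 2) K) p.1 p.2

/-- The function `(A, t) ↦ t det A`. -/
def tdet (x : Matrix.GeneralLinearGroup (Fin 2) K × Kˣ) : K :=
  x.2 * (x.1 : Matrix (Fin 2) (Fin 2) K).det

/-- The polynomial `t det A`. -/
noncomputable def tdetPoly (K : Type u) [Field K] : MvPolynomial (Option (Fin 2 × Fin 2)) K :=
  MvPolynomial.X none * (MvPolynomial.X (some (0, 0)) * MvPolynomial.X (some (1, 1)) -
    MvPolynomial.X (some (0, 1)) * MvPolynomial.X (some (1, 0)))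

theorem eval_tdetPoly (x : Matrix.GeneralLinearGroup (Fin 2) K × Kˣ) :
    MvPolynomial.eval (entries x) (tdetPoly K) = tdet x := by
  simp [tdetPoly, tdet, entries, Matrix.det_fin_two]

theorem det_ne_zero (A : Matrix.GeneralLinearGroup (Fin 2) K) :
    (A : Matrix (Fin 2) (Fin 2) K).det ≠ 0 :=
  (Matrix.GeneralLinearGroup.det A).ne_zero

theorem tdet_ne_zero (x : Matrix.GeneralLinearGroup (Fin 2) K × Kˣ) : tdet x ≠ 0 :=
  mul_ne_zero x.2.ne_zero (det_ne_zero x.1)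

/-- Regular functions on `GL(2) × GL(1)`. -/
def IsRegularFun (h : Matrix.GeneralLinearGroup (Fin 2) K × Kˣ → K) : Prop :=
  ∃ (n : ℕ) (P : MvPolynomial (Option (Fin 2 × Fin 2)) K),
    ∀ x, h x * tdet x ^ n = MvPolynomial.eval (entries x) P

namespace IsRegularFun

variable {h h' : Matrix.GeneralLinearGroup (Fin 2) K × Kˣ → K}

theorem const (c : K) : IsRegularFun fun _ => c := ⟨0, MvPolynomial.C c, by simp⟩

theorem add (H : IsRegularFun h) (H' : IsRegularFun h') : IsRegularFun fun x => h x + h' x := by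
  obtain ⟨n, P, hP⟩ := H
  obtain ⟨m, Q, hQ⟩ := H'
  refine ⟨n + m, P * tdetPoly K ^ m + Q * tdetPoly K ^ n, fun x => ?_⟩
  simp only [map_add, map_mul, map_pow, eval_tdetPoly, ← hP, ← hQ]
  ring

theorem mul (H : IsRegularFun h) (H' : IsRegularFun h') : IsRegularFun fun x => h x * h' x := by
  obtain ⟨n, P, hP⟩ := H
  obtain ⟨m, Q, hQ⟩ := H'
  refine ⟨n + m, P * Q, fun x => ?_⟩
  simp only [map_mul, ← hP, ← hQ]
  ring

theorem entry (i j : Fin 2) : IsRegularFun (K := K)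
    fun x => (x.1 : Matrix (Fin 2) (Fin 2) K) i j :=
  ⟨0, MvPolynomial.X (some (i, j)), fun x => by simp [entries]⟩

theorem unit : IsRegularFun (K := K) fun x => (x.2 : K) :=
  ⟨0, MvPolynomial.X none, fun x => by simp [entries]⟩

theorem unit_inv : IsRegularFun (K := K) fun x => ((x.2⁻¹ : Kˣ) : K) := by
  refine ⟨1, MvPolynomial.X (some (0, 0)) * MvPolynomial.X (some (1, 1)) -
    MvPolynomial.X (some (0, 1)) * MvPolynomial.X (some (1, 0)), fun x => ?_⟩
  rw [pow_one, tdet, ← mul_assoc, Units.inv_mul, one_mul, Matrix.det_fin_two]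
  simp [entries]

theorem det : IsRegularFun (K := K)
    fun x => ((Matrix.GeneralLinearGroup.det x.1 : Kˣ) : K) := by
  refine ⟨0, MvPolynomial.X (some (0, 0)) * MvPolynomial.X (some (1, 1)) -
    MvPolynomial.X (some (0, 1)) * MvPolynomial.X (some (1, 0)), fun x => ?_⟩
  rw [pow_zero, mul_one]
  beta_reduce
  rw [Matrix.GeneralLinearGroup.val_det_apply, Matrix.det_fin_two]
  simp [entries]

theorem det_inv : IsRegularFun (K := K)
    fun x => (((Matrix.GeneralLinearGroup.det x.1)⁻¹ : Kˣ) : K) := by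
  refine ⟨1, MvPolynomial.X none, fun x => ?_⟩
  rw [pow_one, tdet, mul_left_comm, ← Matrix.GeneralLinearGroup.val_det_apply, Units.inv_mul,
    mul_one]
  simp [entries]

theorem inv_entry (i j : Fin 2) : IsRegularFun (K := K)
    fun x => ((x.1⁻¹ : Matrix.GeneralLinearGroup (Fin 2) K) : Matrix (Fin 2) (Fin 2) K) i j := by
  have hi (A : Matrix.GeneralLinearGroup (Fin 2) K) :
      ((A⁻¹ : Matrix.GeneralLinearGroup (Fin 2) K) : Matrix (Fin 2) (Fin 2) K) =
      (((Matrix.GeneralLinearGroup.det A)⁻¹ : Kˣ) : K) •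
        (A : Matrix (Fin 2) (Fin 2) K).adjugate := by
    refine (Units.mul_right_inj A).1 ?_
    rw [Units.mul_inv, mul_smul_comm, Matrix.mul_adjugate, smul_smul,
      ← Matrix.GeneralLinearGroup.val_det_apply, Units.inv_mul, one_smul]
  simp only [hi, Matrix.smul_apply, smul_eq_mul]
  refine det_inv.mul ?_
  have neg (a b : Fin 2) : IsRegularFun (K := K)
      fun x => -(x.1 : Matrix (Fin 2) (Fin 2) K) a b := by
    simpa using (const (-1 : K)).mul (entry a b)
  fin_cases i <;> fin_cases j <;> simp only [Matrix.adjugate_fin_two]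
  · exact entry 1 1
  · exact neg 0 1
  · exact neg 1 0
  · exact entry 0 0

theorem coords_param (q : Fin 7 × Fin 7 ⊕ Fin 2 × Fin 2) :
    IsRegularFun (K := K) fun x => coords (param K x) q := by
  rcases q with ⟨i, j⟩ | ⟨i, j⟩
  · have h (x) : coords (param K x) (Sum.inl (i, j)) = ((x.2⁻¹ : Kˣ) : K) *
        (d₁ x.1 : Matrix (Fin 7) (Fin 7) K) i j := by
      change ((d x.1 * scal x.2).1 : Matrix (Fin 7) (Fin 7) K) i j = _
      rw [d_mul_scal_fst]
      rfl
    simp only [h]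
    refine unit_inv.mul ?_
    fin_cases i <;> fin_cases j <;> first
      | exact const 0
      | exact const 1
      | exact det
      | exact det_inv
      | exact entry _ _
      | exact inv_entry _ _
  · have h (x) : coords (param K x) (Sum.inr (i, j)) =
        ((d x.1 * scal x.2).2 : Matrix (Fin 2) (Fin 2) K) i j := rfl
    simp only [h, d_mul_scal_snd]
    fin_cases i <;> fin_cases j
    · exact unit.mul det
    · exact const 0
    · exact const 0
    · exact unit.mul det_inv

theorem eval_coords_param (p : MvPolynomial (Fin 7 × Fin 7 ⊕ Fin 2 × Fin 2) K) :
    IsRegularFun (K := K) fun x => MvPolynomial.eval (coords (param K x)) p := by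
  induction p using MvPolynomial.induction_on with
  | C a => simpa using const a
  | add p q hp hq => simpa using hp.add hq
  | mul_X p i hp => simpa using hp.mul (coords_param i)

/-- Over an infinite field the product of the two numerators and t det A is nonzero at some point of
affine space; since t det A ≠ 0 there, it is a point of GL(2) × GL(1). -/
theorem exists_mul_ne_zero [Infinite K] (H : IsRegularFun h) (H' : IsRegularFun h')
    (h0 : ∃ x, h x ≠ 0) (h0' : ∃ x, h' x ≠ 0) : ∃ x, h x ≠ 0 ∧ h' x ≠ 0 := by
  obtain ⟨n, P, hP⟩ := H
  obtain ⟨m, Q, hQ⟩ := H'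
  obtain ⟨x, hx⟩ := h0
  obtain ⟨y, hy⟩ := h0'
  have hP0 : P ≠ 0 := by
    rintro rfl
    have := hP x
    rw [map_zero] at this
    exact mul_ne_zero hx (pow_ne_zero _ (tdet_ne_zero x)) this
  have hQ0 : Q ≠ 0 := by
    rintro rfl
    have := hQ y
    rw [map_zero] at this
    exact mul_ne_zero hy (pow_ne_zero _ (tdet_ne_zero y)) this
  have ht0 : tdetPoly K ≠ 0 := fun h => tdet_ne_zero x (by rw [← eval_tdetPoly, h, map_zero])
  obtain ⟨v, hv⟩ : ∃ v, MvPolynomial.eval v (P * Q * tdetPoly K) ≠ 0 := by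
    by_contra! hv
    exact mul_ne_zero (mul_ne_zero hP0 hQ0) ht0 (MvPolynomial.funext fun v => by
      rw [hv v, map_zero])
  rw [map_mul, map_mul] at hv
  have hd : v none * (v (some (0, 0)) * v (some (1, 1)) - v (some (0, 1)) * v (some (1, 0))) ≠ 0 := by
    simpa [tdetPoly] using right_ne_zero_of_mul hv
  let z : Matrix.GeneralLinearGroup (Fin 2) K × Kˣ :=
    (Matrix.GeneralLinearGroup.mkOfDetNeZero (Matrix.of fun i j => v (some (i, j)))
      (by rw [Matrix.det_fin_two]; exact right_ne_zero_of_mul hd),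
      Units.mk0 (v none) (left_ne_zero_of_mul hd))
  have hz : entries z = v := by
    funext q
    rcases q with _ | ⟨i, j⟩ <;> rfl
  refine ⟨z, fun h0 => ?_, fun h0 => ?_⟩
  · have := hP z
    rw [h0, zero_mul, hz] at this
    exact left_ne_zero_of_mul (left_ne_zero_of_mul hv) this.symm
  · have := hQ z
    rw [h0, zero_mul, hz] at this
    exact right_ne_zero_of_mul (left_ne_zero_of_mul hv) this.symm

end IsRegularFun

end Regular

theorem isPreirreducible_range_param (K : Type u) [Field K] [Infinite K] :
    @IsPreirreducible _ (zariski K) (Set.range (param K)) := by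
  let := zariski K
  rintro U V hU hV ⟨_, ⟨x, rfl⟩, hx⟩ ⟨_, ⟨y, rfl⟩, hy⟩
  obtain ⟨_, ⟨p, rfl⟩, hxp, hp⟩ := (zariski_basis K).exists_subset_of_mem_open hx hU
  obtain ⟨_, ⟨q, rfl⟩, hyq, hq⟩ := (zariski_basis K).exists_subset_of_mem_open hy hV
  obtain ⟨z, hzp, hzq⟩ := (IsRegularFun.eval_coords_param p).exists_mul_ne_zero
    (IsRegularFun.eval_coords_param q) ⟨x, hxp⟩ ⟨y, hyq⟩
  exact ⟨_, ⟨z, rfl⟩, hp hzp, hq hzq⟩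

/-- On `Gw` the open sets N₀₀N₁₁ ≠ 0 and N₀₁N₁₀ ≠ 0 cover, because det N ≠ 0, and are disjoint,
because N₀₀N₀₁ = 0. A connected set through 1 stays in the first. Conversely, the image of `param`
is irreducible and contains 1. -/
theorem component_eq (K : Type u) [Field K] [CharZero K] :
    component K = {g | g ∈ Gw K ∧ idem g = 1} := by
  let := zariski K
  have h2 : IsUnit (2 : K) := (two_ne_zero).isUnit
  apply subset_antisymm
  · intro g hg
    have hgw : g ∈ Gw K := connectedComponentIn_subset _ _ hg
    refine ⟨hgw, ?_⟩
    let U (a b c e : Fin 2) : Set (Amb K) := {g | MvPolynomial.eval (coords g)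
      (MvPolynomial.X (Sum.inr (a, b)) * MvPolynomial.X (Sum.inr (c, e))) ≠ 0}
    have hU (a b c e : Fin 2) : IsOpen (U a b c e) :=
      TopologicalSpace.isOpen_generateFrom_of_mem ⟨_, rfl⟩
    have mem (a b c e : Fin 2) (g : Amb K) : g ∈ U a b c e ↔
        (g.2 : Matrix (Fin 2) (Fin 2) K) a b * (g.2 : Matrix (Fin 2) (Fin 2) K) c e ≠ 0 := by
      change MvPolynomial.eval _ _ ≠ 0 ↔ _
      simp [coords]
    have cover {x : Amb K} (hx : x ∉ U 0 0 1 1) : x ∈ U 0 1 1 0 := by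
      rw [mem] at hx ⊢
      rw [not_not] at hx
      intro hx'
      have := det_snd_mul_inv x
      rw [hx, hx', sub_self, zero_mul] at this
      exact zero_ne_one this
    have this : (g.2 : Matrix (Fin 2) (Fin 2) K) 0 0 * (g.2 : Matrix (Fin 2) (Fin 2) K) 1 1 ≠ 0 := by
      rw [← mem]
      by_contra hgU
      obtain ⟨x, hxc, hx1, hx2⟩ := isPreconnected_connectedComponentIn (F := (Gw K : Set (Amb K)))
        (x := 1) _ _ (hU 0 0 1 1) (hU 0 1 1 0) (fun x _ => or_iff_not_imp_left.2 cover)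
        ⟨1, one_mem_component K, (mem _ _ _ _ _).2 (by simp)⟩ ⟨g, hg, cover hgU⟩
      rw [mem] at hx1 hx2
      have h0 := (Gw_snd_mul h2 (connectedComponentIn_subset _ _ hxc)).1
      exact mul_ne_zero (left_ne_zero_of_mul hx1) (left_ne_zero_of_mul hx2) h0
    have hi := idem_isIdempotentElem h2 hgw
    refine (IsIdempotentElem.iff_eq_zero_or_one.1 hi).resolve_left ?_
    exact mul_ne_zero this (Units.ne_zero _)
  · rintro g ⟨hg, h1⟩
    obtain ⟨x, hx⟩ := (mem_range_param_iff h2 hg).2 h1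
    refine IsPreconnected.subset_connectedComponentIn
      (isPreirreducible_range_param K).isPreconnected ⟨1, map_one _⟩ ?_ ⟨x, hx⟩
    rintro _ ⟨y, rfl⟩
    exact param_mem_Gw y

end

/-! ### Points of `Gw0` over a ring, and the exact sequence -/

section

theorem isUnit_two_of_algebra (k R : Type u) [Field k] [CharZero k] [CommRing R] [Algebra k R] :
    IsUnit (2 : R) := by
  have := (two_ne_zero (α := k)).isUnit.map (algebraMap k R)
  rwa [map_ofNat] at this

/-- The condition at the algebraic closure of the residue field of each prime puts 1 - idem g in
every prime. It is then nilpotent as well as idempotent, hence zero. -/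
theorem mem_Gw0_iff (k : Type u) [Field k] [CharZero k] {R : Type u} [CommRing R] [Algebra k R]
    {g : Amb R} : g ∈ Gw0 R ↔ g ∈ Gw R ∧ idem g = 1 := by
  have h2 := isUnit_two_of_algebra k R
  have char (K : Type u) [Field K] (φ : R →+* K) : CharZero K :=
    charZero_of_injective_ringHom (φ.comp (algebraMap k R)).injective
  refine and_congr_right fun hg => ⟨fun h => ?_, fun h K _ _ φ => ?_⟩
  · have hi := (idem_isIdempotentElem h2 hg).one_sub
    have hnil : IsNilpotent (1 - idem g) := by
      rw [nilpotent_iff_mem_prime]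
      intro p hp
      let φ : R →+* AlgebraicClosure (FractionRing (R ⧸ p)) :=
        (algebraMap (FractionRing (R ⧸ p)) _).comp
          ((algebraMap (R ⧸ p) (FractionRing (R ⧸ p))).comp (Ideal.Quotient.mk p))
      have := char _ φ
      have h1 := h _ φ
      rw [component_eq] at h1
      have h1 : idem (Amb.map φ g) = 1 := h1.2
      rw [idem_map, ← sub_eq_zero, ← map_one φ, ← map_sub] at h1
      have h3 : Ideal.Quotient.mk p (idem g - 1) = 0 := (IsFractionRing.injective (R ⧸ p) (FractionRing (R ⧸ p)))
        (((algebraMap (FractionRing (R ⧸ p)) _).injective (h1.trans (map_zero _).symm)).trans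
          (map_zero _).symm)
      rw [Ideal.Quotient.eq_zero_iff_mem] at h3
      rwa [← neg_mem_iff, neg_sub]
    obtain ⟨n, hn⟩ := hnil
    have h0 : 1 - idem g = 0 := by
      rw [← hi.pow_succ_eq n, pow_succ, hn, zero_mul]
    exact (sub_eq_zero.1 h0).symm
  · have := char K φ
    rw [component_eq]
    exact ⟨map_mem_Gw φ hg, by rw [idem_map, h, map_one]⟩

/-! ### Idempotents and locally constant functions to `ℤ/2` -/

section Z2

variable {R S : Type u} [CommRing R] [CommRing S]

theorem mul_eq_one_iff_iff (a b : Multiplicative (ZMod 2)) : a * b = 1 ↔ (a = 1 ↔ b = 1) := by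
  revert a b
  decide

theorem eq_of_eq_one_iff {a b : Multiplicative (ZMod 2)} (h : a = 1 ↔ b = 1) : a = b := by
  revert a b
  decide

theorem Z2.ext {x y : Z2 R} (h : ∀ p, x p = 1 ↔ y p = 1) : x = y :=
  LocallyConstant.ext fun p => eq_of_eq_one_iff (h p)

theorem IsIdempotentElem.ext_of_mem_iff {e f : R} (he : IsIdempotentElem e)
    (hf : IsIdempotentElem f) (h : ∀ p : PrimeSpectrum R, e ∉ p.asIdeal ↔ f ∉ p.asIdeal) :
    e = f :=
  PrimeSpectrum.basicOpen_injOn_isIdempotentElem he hf (TopologicalSpace.Opens.ext (Set.ext h))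

theorem IsIdempotentElem.mix {e f : R} (he : IsIdempotentElem e) (hf : IsIdempotentElem f) :
    IsIdempotentElem (e * f + (1 - e) * (1 - f)) := by
  have he := he.eq
  have hf := hf.eq
  unfold IsIdempotentElem
  grind

theorem mix_notMem_iff {e f : R} (he : IsIdempotentElem e) (hf : IsIdempotentElem f)
    (p : PrimeSpectrum R) :
    e * f + (1 - e) * (1 - f) ∉ p.asIdeal ↔ (e ∉ p.asIdeal ↔ f ∉ p.asIdeal) := by
  simp only [← Ideal.Quotient.eq_zero_iff_mem, map_add, map_mul, map_sub, map_one]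
  rcases IsIdempotentElem.iff_eq_zero_or_one.1 (he.map (Ideal.Quotient.mk p.asIdeal)) with h | h <;>
  rcases IsIdempotentElem.iff_eq_zero_or_one.1 (hf.map (Ideal.Quotient.mk p.asIdeal)) with h' | h' <;>
  simp [h, h']

/-- The locally constant function which is trivial where `e = 1`. -/
noncomputable def toZ2 (e : R) (he : IsIdempotentElem e) : Z2 R := by
  classical
  -- `LocallyConstant.ofIsClopen` takes the value 0 on the clopen set, so 0 goes to the neutral
  -- element.
  exact (LocallyConstant.ofIsClopen (PrimeSpectrum.isClopen_iff.2 ⟨e, he, rfl⟩)).map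
    fun i => if i = 0 then 1 else Multiplicative.ofAdd 1

theorem toZ2_apply_eq_one_iff {e : R} (he : IsIdempotentElem e) (p : PrimeSpectrum R) :
    toZ2 e he p = 1 ↔ e ∉ p.asIdeal := by
  classical
  change (if (if p ∈ (PrimeSpectrum.basicOpen e : Set (PrimeSpectrum R)) then (0 : Fin 2) else 1) = 0
    then 1 else Multiplicative.ofAdd (1 : ZMod 2)) = 1 ↔ _
  by_cases h : p ∈ (PrimeSpectrum.basicOpen e : Set (PrimeSpectrum R))
  · rw [if_pos h]
    exact iff_of_true (if_pos rfl) h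
  · rw [if_neg h]
    exact iff_of_false (by decide) h

theorem exists_idempotent (x : Z2 R) :
    ∃ e : R, IsIdempotentElem e ∧ ∀ p, x p = 1 ↔ e ∉ p.asIdeal := by
  obtain ⟨e, he, h⟩ := PrimeSpectrum.exists_idempotent_basicOpen_eq_of_isClopen
    (x.isLocallyConstant.isClopen_fiber 1)
  exact ⟨e, he, fun p => Set.ext_iff.1 h p⟩

/-- The idempotent of `R` which is `1` where `x` is trivial. -/
noncomputable def ofZ2 (x : Z2 R) : R := (exists_idempotent x).choose

theorem ofZ2_isIdempotentElem (x : Z2 R) : IsIdempotentElem (ofZ2 x) :=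
  (exists_idempotent x).choose_spec.1

theorem ofZ2_notMem_iff (x : Z2 R) (p : PrimeSpectrum R) : ofZ2 x ∉ p.asIdeal ↔ x p = 1 :=
  ((exists_idempotent x).choose_spec.2 p).symm

theorem ofZ2_mul (x y : Z2 R) :
    ofZ2 (x * y) = ofZ2 x * ofZ2 y + (1 - ofZ2 x) * (1 - ofZ2 y) := by
  have hx := ofZ2_isIdempotentElem x
  have hy := ofZ2_isIdempotentElem y
  refine IsIdempotentElem.ext_of_mem_iff (ofZ2_isIdempotentElem _) (IsIdempotentElem.mix hx hy)
    fun p => ?_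
  rw [mix_notMem_iff hx hy, ofZ2_notMem_iff, ofZ2_notMem_iff, ofZ2_notMem_iff,
    LocallyConstant.mul_apply, mul_eq_one_iff_iff]

theorem ofZ2_gen : ofZ2 (Z2.gen R) = 0 :=
  IsIdempotentElem.ext_of_mem_iff (ofZ2_isIdempotentElem _) .zero fun p => by
    rw [ofZ2_notMem_iff]
    exact iff_of_false (by change Multiplicative.ofAdd (1 : ZMod 2) ≠ 1; decide) (by simp)

theorem ofZ2_map (φ : R →+* S) (x : Z2 R) : ofZ2 (Z2.map φ x) = φ (ofZ2 x) :=
  IsIdempotentElem.ext_of_mem_iff (ofZ2_isIdempotentElem _) ((ofZ2_isIdempotentElem _).map φ)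
    fun p => by
      rw [ofZ2_notMem_iff]
      exact (ofZ2_notMem_iff x (PrimeSpectrum.comap φ p)).symm

theorem toZ2_ofZ2 (x : Z2 R) : toZ2 (ofZ2 x) (ofZ2_isIdempotentElem x) = x :=
  Z2.ext fun p => by rw [toZ2_apply_eq_one_iff, ofZ2_notMem_iff]

theorem toZ2_eq_one_iff {e : R} (he : IsIdempotentElem e) : toZ2 e he = 1 ↔ e = 1 := by
  refine ⟨fun h => IsIdempotentElem.ext_of_mem_iff he .one fun p => ?_, fun h => Z2.ext fun p => ?_⟩
  · rw [← toZ2_apply_eq_one_iff he, h]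
    exact iff_of_true rfl ((Ideal.ne_top_iff_one _).1 p.2.ne_top)
  · subst h
    rw [toZ2_apply_eq_one_iff]
    exact iff_of_true ((Ideal.ne_top_iff_one _).1 p.2.ne_top) rfl

end Z2

/-! ### The exact sequence -/

section Sequence

variable (R : Type u) [CommRing R]

/-- The projection `G_w → ℤ/2`. -/
noncomputable def projZ2 (k : Type u) [Field k] [CharZero k] (R : Type u) [CommRing R] [Algebra k R] :
    Gw R →* Z2 R :=
  MonoidHom.mk' (fun g => toZ2 (idem (g : Amb R))
    (idem_isIdempotentElem (isUnit_two_of_algebra k R) g.2)) fun g h => Z2.ext fun p => by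
      have h2 := isUnit_two_of_algebra k R
      rw [LocallyConstant.mul_apply, mul_eq_one_iff_iff, toZ2_apply_eq_one_iff,
        toZ2_apply_eq_one_iff, toZ2_apply_eq_one_iff, Subgroup.coe_mul, idem_mul h2 _ h.2,
        mix_notMem_iff (idem_isIdempotentElem h2 g.2) (idem_isIdempotentElem h2 h.2)]

theorem projZ2_apply (k : Type u) [Field k] [CharZero k] (R : Type u) [CommRing R] [Algebra k R]
    (g : Gw R) : projZ2 k R g = toZ2 (idem (g : Amb R))
    (idem_isIdempotentElem (isUnit_two_of_algebra k R) g.2) := rfl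

theorem mem_ker_projZ2 (k : Type u) [Field k] [CharZero k] (R : Type u) [CommRing R] [Algebra k R]
    (g : Gw R) : g ∈ (projZ2 k R).ker ↔ idem (g : Amb R) = 1 := by
  rw [MonoidHom.mem_ker, projZ2_apply, toZ2_eq_one_iff]

/-- The section `ℤ/2 → G_w`. -/
noncomputable def sectionZ2 : Z2 R →* Gw R :=
  MonoidHom.mk' (fun x => (⟨mix (ofZ2 x) (ofZ2_isIdempotentElem x), mix_mem_Gw _⟩ : Gw R))
    fun x y => Subtype.ext (mix_mul (ofZ2_isIdempotentElem x) (ofZ2_isIdempotentElem y)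
      (ofZ2_isIdempotentElem (x * y)) (ofZ2_mul x y)).symm

theorem coe_sectionZ2 (x : Z2 R) :
    (sectionZ2 R x : Amb R) = mix (ofZ2 x) (ofZ2_isIdempotentElem x) := rfl

/-- The isomorphism `GL(1) ≅ T̃`. -/
noncomputable def scalEquiv : Rˣ ≃* Ttilde R :=
  MulEquiv.ofBijective (MonoidHom.mk' (fun t => (⟨scal t, scal_mem_Ttilde t⟩ : Ttilde R))
      fun s t => Subtype.ext (scal_mul s t))
    ⟨fun s t h => congrArg Prod.snd (param_injective (R := R) (a₁ := (1, s)) (a₂ := (1, t)) (by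
        rw [param_apply, param_apply]
        exact congrArg (d 1 * ·) (congrArg Subtype.val h))),
      fun z => (mem_Ttilde_iff.1 z.2).imp fun _ h => Subtype.ext h⟩

/-- The isomorphism `GL(2) × GL(1) ≅ G_w⁰`. -/
noncomputable def paramEquiv (k : Type u) [Field k] [CharZero k] (R : Type u) [CommRing R] [Algebra k R] :
    Matrix.GeneralLinearGroup (Fin 2) R × Rˣ ≃* Gw0 R :=
  MulEquiv.ofBijective ((param R).codRestrict (Gw0 R) fun x =>
      (mem_Gw0_iff k).2 ⟨param_mem_Gw x, idem_param x⟩)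
    ⟨fun _ _ h => param_injective (congrArg Subtype.val h), fun g => by
      obtain ⟨hg, h1⟩ := (mem_Gw0_iff k).1 g.2
      obtain ⟨x, hx⟩ := (mem_range_param_iff (isUnit_two_of_algebra k R) hg).2 h1
      exact ⟨x, Subtype.ext hx⟩⟩

theorem Gw_eq_closure (k : Type u) [Field k] [CharZero k] (R : Type u) [CommRing R] [Algebra k R]
    [ConnectedSpace (PrimeSpectrum R)] :
    Gw R = Subgroup.closure ((Gw0 R : Set (Amb R)) ∪ {τ R}) := by
  have h2 := isUnit_two_of_algebra k R
  apply le_antisymm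
  · intro g hg
    have hi := idem_isIdempotentElem h2 hg
    have hτ : τ R ∈ Subgroup.closure ((Gw0 R : Set (Amb R)) ∪ {τ R}) :=
      Subgroup.subset_closure (Or.inr rfl)
    -- On a connected spectrum the clopen set of an idempotent is empty or everything.
    have h01 : idem g = 1 ∨ idem g = 0 := by
      have hc : IsClopen (PrimeSpectrum.basicOpen (idem g) : Set (PrimeSpectrum R)) :=
        PrimeSpectrum.isClopen_iff.2 ⟨_, hi, rfl⟩
      rcases isClopen_iff.1 hc with h | h
      · right
        exact PrimeSpectrum.basicOpen_injOn_isIdempotentElem hi .zero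
          (TopologicalSpace.Opens.ext (by simp [h]))
      · left
        exact PrimeSpectrum.basicOpen_injOn_isIdempotentElem hi .one
          (TopologicalSpace.Opens.ext (by simp [h]))
    rcases h01 with h | h
    · exact Subgroup.subset_closure (Or.inl ((mem_Gw0_iff k).2 ⟨hg, h⟩))
    -- At two points with `idem` equal to 0 the multiplication law gives 0·0 + 1·1 = 1.
    · have hm : g * τ R ∈ Gw0 R := (mem_Gw0_iff k).2 ⟨mul_mem hg τ_mem_Gw, by
        rw [idem_mul h2 _ τ_mem_Gw, idem_τ, h]; ring⟩
      have hm' : g * τ R ∈ Subgroup.closure ((Gw0 R : Set (Amb R)) ∪ {τ R}) :=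
        Subgroup.subset_closure (Or.inl hm)
      simpa using mul_mem hm' (inv_mem hτ)
  · rw [Subgroup.closure_le]
    rintro g (hg | rfl)
    · exact hg.1
    · exact τ_mem_Gw

end Sequence

end

end CaseTwo

theorem mainTheorem3 (k : Type u) [Field k] [CharZero k] :
    -- the kernel `T̃` of the action is `{(t⁻¹ I₇, t I₂)} ≅ GL(1)`
    (∀ (R : Type u) [CommRing R] [Algebra k R],
      ∃ Θ : Rˣ ≃* CaseTwo.Ttilde R, ∀ t : Rˣ, (Θ t : CaseTwo.Amb R) = CaseTwo.scal t) ∧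
    -- `GL(2) × T̃ ≅ G_w⁰` through `(A, z) ↦ d(A) z`
    (∀ (R : Type u) [CommRing R] [Algebra k R],
      ∃ Φ : Matrix.GeneralLinearGroup (Fin 2) R × CaseTwo.Ttilde R ≃* CaseTwo.Gw0 R,
        ∀ (A : Matrix.GeneralLinearGroup (Fin 2) R) (z : CaseTwo.Ttilde R),
          (Φ (A, z) : CaseTwo.Amb R) = CaseTwo.d A * (z : CaseTwo.Amb R)) ∧
    -- `G_w` is generated by `G_w⁰` and `τ`
    (∀ (R : Type u) [CommRing R] [Algebra k R] [ConnectedSpace (PrimeSpectrum R)],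
      CaseTwo.Gw R =
        Subgroup.closure ((CaseTwo.Gw0 R : Set (CaseTwo.Amb R)) ∪ {CaseTwo.τ R})) ∧
    -- the split exact sequence `1 → GL(2) × GL(1) → G_w → ℤ/2 → 1` of algebraic groups over `k`
    (∃ (ι : ∀ (R : Type u) [CommRing R] [Algebra k R],
          Matrix.GeneralLinearGroup (Fin 2) R × Rˣ →* CaseTwo.Gw R)
        (π : ∀ (R : Type u) [CommRing R] [Algebra k R], CaseTwo.Gw R →* CaseTwo.Z2 R)
        (s : ∀ (R : Type u) [CommRing R] [Algebra k R], CaseTwo.Z2 R →* CaseTwo.Gw R),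
      -- `ι`, `π`, `s` on `R`-points, and exactness
      (∀ (R : Type u) [CommRing R] [Algebra k R],
        (∀ (A : Matrix.GeneralLinearGroup (Fin 2) R) (t : Rˣ),
          (ι R (A, t) : CaseTwo.Amb R) = CaseTwo.d A * CaseTwo.scal t) ∧
        Function.Injective (ι R) ∧
        (ι R).range = (π R).ker ∧
        (π R).ker = (CaseTwo.Gw0 R).subgroupOf (CaseTwo.Gw R) ∧
        Function.Surjective (π R) ∧
        (∀ x : CaseTwo.Z2 R, π R (s R x) = x) ∧
        (s R (CaseTwo.Z2.gen R) : CaseTwo.Amb R) = CaseTwo.τ R) ∧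
      -- `G_w` is stable under extension of scalars, and `π` and `s` are natural
      (∀ (R S : Type u) [CommRing R] [CommRing S] [Algebra k R] [Algebra k S] (φ : R →ₐ[k] S),
        (∀ g : CaseTwo.Gw R, ∃ h : CaseTwo.Gw S,
          (h : CaseTwo.Amb S) = CaseTwo.Amb.map (φ : R →+* S) (g : CaseTwo.Amb R) ∧
          π S h = CaseTwo.Z2.map (φ : R →+* S) (π R g)) ∧
        (∀ x : CaseTwo.Z2 R,
          (s S (CaseTwo.Z2.map (φ : R →+* S) x) : CaseTwo.Amb S) =
            CaseTwo.Amb.map (φ : R →+* S) (s R x : CaseTwo.Amb R)))) := by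
  refine ⟨fun R _ _ => ⟨CaseTwo.scalEquiv R, fun _ => rfl⟩, fun R _ _ =>
    ⟨((MulEquiv.refl _).prodCongr (CaseTwo.scalEquiv R).symm).trans (CaseTwo.paramEquiv k R),
      fun A z => ?_⟩, fun R _ _ _ => CaseTwo.Gw_eq_closure k R,
    fun R _ _ => (CaseTwo.param R).codRestrict (CaseTwo.Gw R) CaseTwo.param_mem_Gw,
    fun R _ _ => CaseTwo.projZ2 k R, fun R _ _ => CaseTwo.sectionZ2 R, fun R _ _ => ?_,
    fun R S _ _ _ _ φ => ⟨fun g => ?_, fun x => ?_⟩⟩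
  · obtain ⟨t, rfl⟩ := (CaseTwo.scalEquiv R).surjective z
    have h : (((MulEquiv.refl _).prodCongr (CaseTwo.scalEquiv R).symm).trans
        (CaseTwo.paramEquiv k R)) (A, CaseTwo.scalEquiv R t) = CaseTwo.paramEquiv k R (A, t) := by
      rw [MulEquiv.trans_apply]
      exact congrArg (fun z => CaseTwo.paramEquiv k R (A, z))
        ((CaseTwo.scalEquiv R).symm_apply_apply t)
    rw [h]
    rfl
  · have h2 := CaseTwo.isUnit_two_of_algebra k R
    have hs (x : CaseTwo.Z2 R) : CaseTwo.projZ2 k R (CaseTwo.sectionZ2 R x) = x := by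
      -- Writing x as `toZ2` of its idempotent reduces the claim to `idem_mix`.
      rw [← CaseTwo.toZ2_ofZ2 x, CaseTwo.projZ2_apply]
      congr 1
      rw [CaseTwo.toZ2_ofZ2, CaseTwo.coe_sectionZ2, CaseTwo.idem_mix]
    refine ⟨fun A t => rfl,
      fun x y h => CaseTwo.param_injective (congrArg Subtype.val h), ?_, ?_,
      fun x => ⟨_, hs x⟩, hs, ?_⟩
    · ext g
      rw [CaseTwo.mem_ker_projZ2, ← CaseTwo.mem_range_param_iff h2 g.2]
      exact exists_congr fun x => Subtype.ext_iff
    · ext g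
      rw [CaseTwo.mem_ker_projZ2, Subgroup.mem_subgroupOf, CaseTwo.mem_Gw0_iff k]
      exact (and_iff_right g.2).symm
    · rw [CaseTwo.coe_sectionZ2, ← CaseTwo.mix_zero]
      congr 1
      exact CaseTwo.ofZ2_gen
  · refine ⟨⟨_, CaseTwo.map_mem_Gw (φ : R →+* S) g.2⟩, rfl, CaseTwo.Z2.ext fun p => ?_⟩
    rw [CaseTwo.projZ2_apply, CaseTwo.toZ2_apply_eq_one_iff, CaseTwo.idem_map]
    exact (CaseTwo.toZ2_apply_eq_one_iff
      (CaseTwo.idem_isIdempotentElem (CaseTwo.isUnit_two_of_algebra k R) g.2)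
      (PrimeSpectrum.comap (φ : R →+* S) p)).symm
  · rw [CaseTwo.coe_sectionZ2, CaseTwo.coe_sectionZ2]
    exact (CaseTwo.map_mix _ _ _ (CaseTwo.ofZ2_map _ _).symm).symm
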